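/- **Setting.** Let $k,l\ge 1$ be relatively prime integers. Identify $\mathbb R^2=\mathbb C$, and for coprime $p,q\ge1$ let the $(p,q)$-torus knot be $\{\tfrac1{\sqrt2}(e^{ip\theta},e^{iq\theta}):\theta\in\mathbb R\}\subset S^3\subset\mathbb C^2$. A closed curve in $S^3$ "is a $(p,q)$-torus knot" if it is a simple closed curve whose image is ambient isotopic in $S^3$ to this one. A point with position $x=x_1+ix_2$ and conjugate momentum $y=y_1+iy_2$ is viewed as the point $(x_1+iy_1,x_2+iy_2)$ of $\mathbb C^2$. **Rotating Kepler problem**, $H_{\rm RKP}=\tfrac12|p|^2-\tfrac1{|q|}+q_1p_2-q_2p_1$. Collisions are regularized by the Levi-Civita coordinates $q=z^2$, $p=w/(2\bar z)$: orbits of energy $c$ in physical time $t$ lift to orbits on the zero level of $K_c=|z|^2(H_{\rm RKP}-c)$ (extended smoothly to $z=0$) in the time $\tau$ with $dt=|z|^2d\tau$; the lift is unique up to $(z,w)\mapsto(-z,-w)$ and the choice of the initial time. It is regarded as a closed curve in $S^3$ by radial projection $\mathbb C^2\setminus\{0\}\to S^3$ (for $c<-3/2$ the bounded component of $\{K_c=0\}$,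 which doubly covers the regularized energy hypersurface $\cong\mathbb RP^3$, is strictly star-shaped about $0$, so this is a homeomorphism of it onto $S^3$). A $T_{k,l}$-type orbit is a regularized orbit of the form $\gamma^{\rm RKP}(t)=e^{it}\gamma(t)$, where $\gamma$ is a Kepler ellipse (negative energy, not circular, collision orbits allowed) of minimal period $T$ with $kT=2\pi l$; it is assumed that $k>l$. **Euler problem**, $H_{\rm Euler}=\tfrac12|p|^2-\tfrac{1-\mu}{|q-E|}-\tfrac{\mu}{|q-M|}$ with $0<\mu<1$, $E=(-\tfrac12,0)$, $M=(\tfrac12,0)$, at energies $c<-1-2\sqrt{\mu(1-\mu)}$, where the Hill's region has one component around $E$ and one around $M$. In the doubly covered elliptic coordinates $q=\tfrac12\cosh(\lambda+i\nu)$ with canonical momenta $p_\lambda,p_\nu$, regularized orbits of energy $c$ lift to orbits on the zero level of $K=(H_{\rm Euler}-c)(\cosh^2\lambda-\cos^2\nu)$ in the time $\tau$ with $dt=(\cosh^2\lambda-\cos^2\nu)\,d\tau$. A lift that moves around a branch point $Q_0$ of the coordinates $Q=\lambda+i\nu$ is regarded as a curve in $S^3$ by radial projection from $(Q_0,0)$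 (the component of $\{K=0\}$ around $Q_0$, which doubly covers a component $\cong\mathbb RP^3$ of the regularized energy hypersurface, is strictly star-shaped about $(Q_0,0)$). An orbit is of $T_{k,l}$-type if $(\lambda,p_\lambda)$ and $(\nu,p_\nu)$ have minimal periods $T_\lambda,T_\nu>0$ with $T_\nu/T_\lambda=k/l$ (in particular neither is constant). **Proposition.** (i) If $k>l$, any lift to $S^3$ of a $T_{k,l}$-type orbit of the rotating Kepler problem is a $(k+l,k-l)$-torus knot if $k+l$ is odd, and a $\left(\frac{k+l}2,\frac{k-l}2\right)$-torus knot if $k+l$ is even. (ii) Any lift to $S^3$ of a $T_{k,l}$-type orbit of the Euler problem, around either of the two centers and at an energy $c<-1-2\sqrt{\mu(1-\mu)}$, is a $(k,l)$-torus knot. -/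

import Mathlib

noncomputable section

namespace CelestialKnots

/-! ### Knots in the three-sphere -/

/-- The three-sphere, as the unit sphere of `ℂ²`. -/
abbrev S3 : Type := Metric.sphere (0 : EuclideanSpace ℂ (Fin 2)) 1

/-- Two subsets of `S³` are ambient isotopic: a continuous path of self-homeomorphisms of `S³`
starting at the identity ends at a homeomorphism that carries one onto the other. -/
def AmbientIsotopic (A B : Set S3) : Prop :=
  ∃ Φ : unitInterval → (S3 ≃ₜ S3),
    Continuous (fun x : unitInterval × S3 => Φ x.1 x.2) ∧
    Φ 0 = Homeomorph.refl S3 ∧ Φ 1 '' A = B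

/-- The standard (positive) `(p, q)`-torus knot, for coprime `p` and `q`: it winds `p` times in the
first coordinate and `q` times in the second one on the torus `|u₁| = |u₂| = 1/√2`. -/
def torusKnot (p q : ℕ) : Set S3 :=
  {u | ∃ θ : ℝ, (u : EuclideanSpace ℂ (Fin 2)) =
    !₂[Complex.exp ((p : ℂ) * θ * Complex.I) / (√2 : ℝ),
       Complex.exp ((q : ℂ) * θ * Complex.I) / (√2 : ℝ)]}

/-- The curve `κ` in `S³` is a simple closed curve (run through periodically) whose image is
ambient isotopic to the `(p, q)`-torus knot. -/
def IsTorusKnot (p q : ℕ) (κ : ℝ → S3) : Prop :=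
  Continuous κ ∧
  (∃ T : ℝ, 0 < T ∧ Function.Periodic κ T ∧ Set.InjOn κ (Set.Ico 0 T)) ∧
  AmbientIsotopic (Set.range κ) (torusKnot p q)

/-- A point of the phase space `T*ℝ² = T*ℂ`, with position `x = x₁ + i x₂` and momentum
`y = y₁ + i y₂`, in the coordinates `(x₁ + i y₁, x₂ + i y₂)` of the symplectic vector space `ℂ²`. -/
def phasePoint (x y : ℂ) : EuclideanSpace ℂ (Fin 2) := !₂[⟨x.re, y.re⟩, ⟨x.im, y.im⟩]

/-- The radial projection of `ℂ² \ {0}` to `S³`. (The value at the origin is irrelevant.) -/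
def radial (v : EuclideanSpace ℂ (Fin 2)) : S3 :=
  if h : v = 0 then ⟨EuclideanSpace.single 0 1, by simp⟩
  else ⟨‖v‖⁻¹ • v, by simp [norm_smul, h]⟩

/-- The curve in `S³` obtained from a curve `(x, y)` in `T*ℂ`, that avoids `(x₀, 0)`, by radial
projection from the point `(x₀, 0)`. A hypersurface that is strictly star-shaped with respect to
`(x₀, 0)` is mapped homeomorphically onto `S³` by this projection. -/
def sphereCurve (x₀ : ℂ) (x y : ℝ → ℂ) (τ : ℝ) : S3 := radial (phasePoint (x τ - x₀) (y τ))

/-! ### Hamiltonian systems on `T*ℂ` -/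

/-- `(x, y)` solves Hamilton's equations `x' = ∂K/∂y`, `y' = -∂K/∂x` of the Hamiltonian `K` on
`T*ℂ = T*ℝ²` (gradients for the real inner product of `ℂ`) and lies on the level set `K = 0`. -/
structure IsZeroEnergyOrbit (K : ℂ → ℂ → ℝ) (x y : ℝ → ℂ) : Prop where
  position : ∀ τ, HasDerivAt x (gradient (fun v => K (x τ) v) (y τ)) τ
  momentum : ∀ τ, HasDerivAt y (-gradient (fun u => K u (y τ)) (x τ)) τ
  energy : ∀ τ, K (x τ) (y τ) = 0

/-- `T` is the smallest positive period of `f`. (A constant function has none.) -/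
def IsMinimalPeriod {α : Type*} (f : ℝ → α) (T : ℝ) : Prop :=
  0 < T ∧ Function.Periodic f T ∧ ∀ S : ℝ, 0 < S → Function.Periodic f S → T ≤ S

/-! ### The Kepler problem and the rotating Kepler problem -/

/-- The Kepler energy `E = |p|²/2 - 1/|q|`. -/
def keplerHamiltonian (q p : ℂ) : ℝ := ‖p‖ ^ 2 / 2 - 1 / ‖q‖

/-- The angular momentum `L = q₁ p₂ - q₂ p₁`. -/
def angularMomentum (q p : ℂ) : ℝ := q.re * p.im - q.im * p.re

/-- The Hamiltonian of the rotating Kepler problem. -/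
def rkpHamiltonian (q p : ℂ) : ℝ := keplerHamiltonian q p + angularMomentum q p

/-- The Levi-Civita regularization of the Kepler problem at energy `e`. -/
def keplerReg (e : ℝ) (z w : ℂ) : ℝ := ‖w‖ ^ 2 / 8 - 1 - e * ‖z‖ ^ 2

/-- The Levi-Civita regularization of the rotating Kepler problem at energy `c`. For `c < -3/2` the
bounded component of `{rkpReg c = 0}` is strictly star-shaped with respect to the origin: it is the
three-sphere that doubly covers the regularized energy hypersurface. At every energy `c`, the points
of `{rkpReg c = 0}` of a fixed Kepler energy `e < 0` lie on the ellipsoid `{keplerReg e = 0}`. -/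
def rkpReg (c : ℝ) (z w : ℂ) : ℝ :=
  ‖w‖ ^ 2 / 8 - 1 + ‖z‖ ^ 2 * (angularMomentum z w / 2 - c)

/-- The regularized Hamiltonian is `|z|² (E - e)`, transformed by the cotangent lift
`q = z²`, `p = w / (2 z̄)` of the squaring map. -/
theorem keplerReg_eq (e : ℝ) (z w : ℂ) (hz : z ≠ 0) :
    keplerReg e z w =
      ‖z‖ ^ 2 * (keplerHamiltonian (z ^ 2) (w / (2 * (starRingEnd ℂ) z)) - e) := by
  have h : ‖z‖ ≠ 0 := by simpa using hz
  simp only [keplerReg, keplerHamiltonian, norm_div, norm_mul, norm_pow, RCLike.norm_conj,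
    Complex.norm_ofNat]
  field_simp
  ring

/-- The regularized Hamiltonian is `|z|² (H - c)`, transformed by the cotangent lift
`q = z²`, `p = w / (2 z̄)` of the squaring map. -/
theorem rkpReg_eq (c : ℝ) (z w : ℂ) (hz : z ≠ 0) :
    rkpReg c z w =
      ‖z‖ ^ 2 * (rkpHamiltonian (z ^ 2) (w / (2 * (starRingEnd ℂ) z)) - c) := by
  have h := keplerReg_eq c z w hz
  have hL : angularMomentum (z ^ 2) (w / (2 * (starRingEnd ℂ) z)) = angularMomentum z w / 2 := by
    have e1 : ∀ a b : ℂ, angularMomentum a b = ((starRingEnd ℂ) a * b).im := by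
      intro a b; simp [angularMomentum]; ring
    have hz' : (starRingEnd ℂ) z ≠ 0 := by simpa using hz
    rw [e1, e1]
    have e2 : (starRingEnd ℂ) (z ^ 2) * (w / (2 * (starRingEnd ℂ) z))
        = ((2⁻¹ : ℝ) : ℂ) * ((starRingEnd ℂ) z * w) := by
      rw [map_pow]; push_cast; field_simp
    rw [e2, Complex.im_ofReal_mul]
    ring
  simp only [rkpHamiltonian, hL]
  simp only [keplerReg] at h
  simp only [rkpReg]
  linear_combination h

/-- `(z, w)` is a Levi-Civita lift of the trajectory `q`: it is an orbit of the regularized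
Hamiltonian `K` on `K = 0`, and `z²` is the position `q`, where the physical time `t` and the
parameter `τ` of the regularized flow are related by `dt = |z|² dτ`. In particular `q` is allowed
to pass through collisions with the origin. The other lift of `q` is `(-z, -w)`. -/
def IsLeviCivitaLift (K : ℂ → ℂ → ℝ) (q : ℝ → ℂ) (z w : ℝ → ℂ) : Prop :=
  IsZeroEnergyOrbit K z w ∧
  ∃ t : ℝ → ℝ, (∀ τ, HasDerivAt t (‖z τ‖ ^ 2) τ) ∧ ∀ τ, q (t τ) = z τ ^ 2

/-- `γ` is a Kepler ellipse of (minimal) period `T`: a (regularized) Kepler orbit of negative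
energy which is not circular. Collision orbits count as degenerate ellipses. -/
def IsKeplerEllipse (γ : ℝ → ℂ) (T : ℝ) : Prop :=
  (∃ e : ℝ, e < 0 ∧ ∃ z w : ℝ → ℂ, IsLeviCivitaLift (keplerReg e) γ z w) ∧
  (¬ ∃ r : ℝ, ∀ t, ‖γ t‖ = r) ∧
  IsMinimalPeriod γ T

/-- The trajectory `q` is a `T_{k,l}`-type orbit of the rotating Kepler problem of energy `c`: it
is a (regularized) orbit of energy `c` and has the form `q(t) = exp(it) γ(t)` for a Kepler
ellipse `γ` of period `T` with `k T = 2 π l`. -/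
def IsTypeRKP (k l : ℕ) (c : ℝ) (q : ℝ → ℂ) : Prop :=
  (∃ z w : ℝ → ℂ, IsLeviCivitaLift (rkpReg c) q z w) ∧
  ∃ (γ : ℝ → ℂ) (T : ℝ), IsKeplerEllipse γ T ∧ (k : ℝ) * T = 2 * Real.pi * l ∧
    ∀ t : ℝ, q t = Complex.exp (t * Complex.I) * γ t

/-! ### The Euler problem of two fixed centers -/

/-- The potential of the centers `E = -1/2` of mass `1 - μ` and `M = 1/2` of mass `μ`. -/
def eulerPotential (μ : ℝ) (q : ℂ) : ℝ := -(1 - μ) / ‖q - (-1 / 2)‖ - μ / ‖q - 1 / 2‖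

/-- The Hamiltonian of the Euler problem. -/
def eulerHamiltonian (μ : ℝ) (q p : ℂ) : ℝ := ‖p‖ ^ 2 / 2 + eulerPotential μ q

/-- The critical energy `c₁`. -/
def criticalEnergy (μ : ℝ) : ℝ := -1 - 2 * √(μ * (1 - μ))

/-- The Hill's region of energy `c`, including the two centers, where the potential is `-∞`. -/
def hillRegion (μ c : ℝ) : Set ℂ := {q | q = -1 / 2 ∨ q = 1 / 2 ∨ eulerPotential μ q ≤ c}

/-- The regularized Hamiltonian `K = K_λ + K_ν` of energy `c` in the doubly covered elliptic
coordinates `Q = λ + i ν` with momenta `P = p_λ + i p_ν`. For energies below the critical one, the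
component of `{eulerReg μ c = 0}` around a branch point `Q₀` of the coordinates is strictly
star-shaped with respect to `(Q₀, 0)`: it is the three-sphere that doubly covers the component of
the regularized energy hypersurface around the center `cosh(Q₀)/2`. -/
def eulerReg (μ c : ℝ) (Q P : ℂ) : ℝ :=
  (2 * P.re ^ 2 - 2 * Real.cosh Q.re - c * Real.cosh Q.re ^ 2) +
  (2 * P.im ^ 2 + 2 * (1 - 2 * μ) * Real.cos Q.im + c * Real.cos Q.im ^ 2)

/-- The elliptic coordinates are `q = cosh(Q)/2`, that is,
`q = (cosh λ cos ν / 2, sinh λ sin ν / 2)`. -/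
theorem elliptic_eq (Q : ℂ) : Complex.cosh Q / 2 =
    ⟨Real.cosh Q.re * Real.cos Q.im / 2, Real.sinh Q.re * Real.sin Q.im / 2⟩ := by
  have h : Complex.cosh Q = Complex.cosh (Q.re + Q.im * Complex.I) := by rw [Complex.re_add_im]
  rw [h, Complex.cosh_add, Complex.cosh_mul_I, Complex.sinh_mul_I, ← Complex.ofReal_cosh,
    ← Complex.ofReal_cos, ← Complex.ofReal_sinh, ← Complex.ofReal_sin]
  apply Complex.ext
  · rw [← Complex.ofReal_ofNat 2, Complex.div_ofReal_re]
    simp only [Complex.add_re, Complex.mul_re, Complex.mul_im, Complex.ofReal_re,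
      Complex.ofReal_im, Complex.I_re, Complex.I_im]
    ring
  · rw [← Complex.ofReal_ofNat 2, Complex.div_ofReal_im]
    simp only [Complex.add_im, Complex.mul_re, Complex.mul_im, Complex.ofReal_re,
      Complex.ofReal_im, Complex.I_re, Complex.I_im]
    ring

/-- The distance from the center `-1/2` in elliptic coordinates. -/
theorem dist_left (Q : ℂ) :
    ‖Complex.cosh Q / 2 - (-1 / 2)‖ = (Real.cosh Q.re + Real.cos Q.im) / 2 := by
  have h0 : 0 ≤ (Real.cosh Q.re + Real.cos Q.im) / 2 := by
    linarith [Real.one_le_cosh Q.re, Real.neg_one_le_cos Q.im]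
  rw [elliptic_eq, ← sq_eq_sq₀ (norm_nonneg _) h0, ← Complex.normSq_eq_norm_sq,
    Complex.normSq_apply]
  have hr : (-1 / 2 : ℂ) = ((-1 / 2 : ℝ) : ℂ) := by push_cast; ring
  rw [hr]
  simp only [Complex.sub_re, Complex.sub_im, Complex.ofReal_re, Complex.ofReal_im]
  linear_combination (Real.sin Q.im ^ 2 / 4) * (-Real.cosh_sq Q.re) +
    (Real.cosh Q.re ^ 2 / 4 - 1 / 4) * Real.sin_sq_add_cos_sq Q.im

/-- The distance from the center `1/2` in elliptic coordinates. -/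
theorem dist_right (Q : ℂ) :
    ‖Complex.cosh Q / 2 - 1 / 2‖ = (Real.cosh Q.re - Real.cos Q.im) / 2 := by
  have h0 : 0 ≤ (Real.cosh Q.re - Real.cos Q.im) / 2 := by
    linarith [Real.one_le_cosh Q.re, Real.cos_le_one Q.im]
  rw [elliptic_eq, ← sq_eq_sq₀ (norm_nonneg _) h0, ← Complex.normSq_eq_norm_sq,
    Complex.normSq_apply]
  have hr : (1 / 2 : ℂ) = ((1 / 2 : ℝ) : ℂ) := by push_cast; ring
  rw [hr]
  simp only [Complex.sub_re, Complex.sub_im, Complex.ofReal_re, Complex.ofReal_im]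
  linear_combination (Real.sin Q.im ^ 2 / 4) * (-Real.cosh_sq Q.re) +
    (Real.cosh Q.re ^ 2 / 4 - 1 / 4) * Real.sin_sq_add_cos_sq Q.im

/-- The regularized Hamiltonian is `(cosh² λ - cos² ν) (H - c)`, transformed by the cotangent lift
`q = cosh(Q)/2`, `p = P / conj(sinh(Q)/2)` of the elliptic coordinates. -/
theorem eulerReg_eq (μ c : ℝ) (Q P : ℂ) (hQ : Complex.sinh Q ≠ 0) :
    eulerReg μ c Q P = (Real.cosh Q.re ^ 2 - Real.cos Q.im ^ 2) *
      (eulerHamiltonian μ (Complex.cosh Q / 2)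
        (P / (starRingEnd ℂ) (Complex.sinh Q / 2)) - c) := by
  have hs : ‖Complex.sinh Q‖ ^ 2 =
      (Real.cosh Q.re + Real.cos Q.im) * (Real.cosh Q.re - Real.cos Q.im) := by
    have h1 : Complex.sinh Q ^ 2 =
        4 * ((Complex.cosh Q / 2 - (-1 / 2)) * (Complex.cosh Q / 2 - 1 / 2)) := by
      rw [Complex.sinh_sq]; ring
    rw [← norm_pow, h1, norm_mul, norm_mul, dist_left, dist_right, Complex.norm_ofNat]
    ring
  have hne : ‖Complex.sinh Q‖ ^ 2 ≠ 0 := by simpa using hQ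
  have hP : ‖P‖ ^ 2 = P.re ^ 2 + P.im ^ 2 := by
    rw [← Complex.normSq_eq_norm_sq, Complex.normSq_apply]; ring
  have hp : ‖P / (starRingEnd ℂ) (Complex.sinh Q / 2)‖ ^ 2 =
      4 * (P.re ^ 2 + P.im ^ 2) / ‖Complex.sinh Q‖ ^ 2 := by
    rw [norm_div, RCLike.norm_conj, norm_div, Complex.norm_ofNat, div_pow, div_pow, hP]
    field_simp
    norm_num
  rw [hs] at hne hp
  obtain ⟨ha, hb⟩ := mul_ne_zero_iff.mp hne
  simp only [eulerHamiltonian, eulerPotential, eulerReg, dist_left, dist_right, hp]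
  field_simp
  ring

/-- `(Q, P)` is a lift to the elliptic coordinates of the trajectory `q`: it is an orbit of the
regularized Hamiltonian on `K = 0`, and the position is `q = cosh(Q)/2`, where the physical time
`t` and the parameter `τ` are related by `dt = (cosh² λ - cos² ν) dτ`. -/
def IsEllipticLift (μ c : ℝ) (q : ℝ → ℂ) (Q P : ℝ → ℂ) : Prop :=
  IsZeroEnergyOrbit (eulerReg μ c) Q P ∧
  ∃ t : ℝ → ℝ,
    (∀ τ, HasDerivAt t (Real.cosh (Q τ).re ^ 2 - Real.cos (Q τ).im ^ 2) τ) ∧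
    ∀ τ, q (t τ) = Complex.cosh (Q τ) / 2

/-- The orbit `(Q, P)` belongs to the component around the center `cosh(Q₀)/2 = ± 1/2`, where `Q₀`
is a branch point of the elliptic coordinates (`sinh Q₀ = 0`): its position is in the
connected component of `Q₀` of the preimage of the Hill's region. -/
def AroundCenter (μ c : ℝ) (Q₀ : ℂ) (Q : ℝ → ℂ) : Prop :=
  Complex.sinh Q₀ = 0 ∧
  Q 0 ∈ connectedComponentIn {u : ℂ | Complex.cosh u / 2 ∈ hillRegion μ c} Q₀

/-- The trajectory `q` is a `T_{k,l}`-type orbit of the Euler problem of energy `c`, with the lift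
`(Q, P)` to the elliptic coordinates: the minimal period `T_λ` of `(λ, p_λ)` and the
minimal period `T_ν` of `(ν, p_ν)` satisfy `R = T_ν / T_λ = k / l`. The existence of these periods
says that neither `λ` nor `ν` is at rest, which excludes the two critical collision orbits. -/
def IsTypeEuler (k l : ℕ) (μ c : ℝ) (q : ℝ → ℂ) (Q P : ℝ → ℂ) : Prop :=
  IsEllipticLift μ c q Q P ∧
  ∃ Tl Tn : ℝ,
    IsMinimalPeriod (fun τ => ((Q τ).re, (P τ).re)) Tl ∧
    IsMinimalPeriod (fun τ => ((Q τ).im, (P τ).im)) Tn ∧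
    Tn / Tl = (k : ℝ) / l

end CelestialKnots

end

noncomputable section

namespace CelestialKnots

open Set Function Filter Topology

/-! ### Radial projection -/

/-! Radial projection turns positively homogeneous bijections of `ℂ²` into homeomorphisms of `S³`. A
curve may therefore be deformed in `ℂ²` by any `HomogeneousIsotopy` without changing its knot type
(`IsTorusKnot.of_homogeneousIsotopy`). In both parts such deformations end at a linear flow on the
Clifford torus, which is a torus knot by `isTorusKnot_linear`.

Euler problem: the regularized Hamiltonian separates, so the two coordinates of the phase point are
the phase curves of two systems with one degree of freedom. Below the critical energy each of them
moves in a potential well centered at the branch point. Its phase curve then winds once clockwise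
around the origin in a minimal period, with strictly monotone argument (`exists_windingLog`). A
homogeneous isotopy of the plane makes such a curve a uniformly traversed unit circle
(`IsWindingLog.exists_planarIsotopy`). The product of two such isotopies leaves a linear flow with
frequencies in the ratio `1/T₁ : 1/T₂ = k : l`. Both circles run clockwise, so the knot is the
positive one.

Rotating Kepler problem: rotating the lift by minus half the physical time gives the Levi-Civita
flow of the Kepler problem, a harmonic oscillator `A exp(iωτ) + B exp(-iωτ)`
(`IsKeplerFlow.exists_eq`). After the momenta are rescaled, the complex linear change to `v₀ ∓ i v₁`
turns the lift into a pair of exponentials with phases `-(t/2 + ωτ)` and `t/2 - ωτ`. By Kepler's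
equation `t` is linear in `τ` up to the oscillation `Im (D exp(2iωτ))`. The product of the two
exponentials is `exp(-2iωτ)`, so this oscillation is a function of the point of `ℂ²`, and `twist`
removes it. The resonance `kT = 2πl` with `T = π/(4ω³)` makes the remaining frequencies proportional
to `k + l` and `k - l`, with equal signs. Their common factor is 1 or 2 according to parity. -/

theorem radial_coe {v : EuclideanSpace ℂ (Fin 2)} (h : v ≠ 0) :
    (radial v : EuclideanSpace ℂ (Fin 2)) = ‖v‖⁻¹ • v := by
  simp [radial, h]

theorem radial_smul {r : ℝ} (hr : 0 < r) (v : EuclideanSpace ℂ (Fin 2)) :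
    radial (r • v) = radial v := by
  by_cases h : v = 0
  · simp [h]
  · have h' : r • v ≠ 0 := smul_ne_zero hr.ne' h
    apply Subtype.ext
    rw [radial_coe h, radial_coe h', norm_smul, Real.norm_of_nonneg hr.le, smul_smul]
    congr 1
    field_simp

theorem sphere_ne_zero (u : S3) : (u : EuclideanSpace ℂ (Fin 2)) ≠ 0 :=
  ne_zero_of_mem_unit_sphere u

theorem radial_sphere (u : S3) : radial (u : EuclideanSpace ℂ (Fin 2)) = u := by
  apply Subtype.ext
  rw [radial_coe (sphere_ne_zero u), norm_eq_of_mem_sphere u]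
  simp

theorem exists_smul_of_radial_eq {v w : EuclideanSpace ℂ (Fin 2)} (hv : v ≠ 0) (hw : w ≠ 0)
    (h : radial v = radial w) : ∃ r : ℝ, 0 < r ∧ v = r • w := by
  have h1 : ‖v‖⁻¹ • v = ‖w‖⁻¹ • w := by rw [← radial_coe hv, ← radial_coe hw, h]
  have hv' := norm_pos_iff.mpr hv
  have hw' := norm_pos_iff.mpr hw
  refine ⟨‖v‖ * ‖w‖⁻¹, by positivity, ?_⟩
  rw [mul_smul, ← h1, smul_smul, mul_inv_cancel₀ hv'.ne', one_smul]

theorem continuous_radial_comp {X : Type*} [TopologicalSpace X]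
    {f : X → EuclideanSpace ℂ (Fin 2)} (hf : Continuous f) (h0 : ∀ x, f x ≠ 0) :
    Continuous fun x => radial (f x) := by
  apply Continuous.subtype_mk (f := fun x => ‖f x‖⁻¹ • f x) _ (fun x => by
    simp [norm_smul, h0 x]) |>.congr
  · intro x
    apply Subtype.ext
    rw [radial_coe (h0 x)]
  · exact (hf.norm.inv₀ fun x => norm_ne_zero_iff.mpr (h0 x)).smul hf

/-! ### Isotopies of the sphere from homogeneous maps -/

/-- A continuous path of bijections of `ℂ²` starting at the identity that are positively
homogeneous of degree one. -/
structure HomogeneousIsotopy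
    (F : ℝ → EuclideanSpace ℂ (Fin 2) → EuclideanSpace ℂ (Fin 2)) : Prop where
  continuous : Continuous fun x : unitInterval × S3 => F x.1 x.2
  bijective : ∀ s ∈ Icc (0 : ℝ) 1, Bijective (F s)
  smul : ∀ (s r : ℝ), 0 < r → ∀ v, F s (r • v) = r • F s v
  zero : ∀ v, F 0 v = v

namespace HomogeneousIsotopy

variable {F : ℝ → EuclideanSpace ℂ (Fin 2) → EuclideanSpace ℂ (Fin 2)}

theorem map_zero (hF : HomogeneousIsotopy F) (s : ℝ) : F s 0 = 0 := by
  have h := hF.smul s 2 two_pos 0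
  rw [smul_zero, two_smul] at h
  exact left_eq_add.mp h

theorem ne_zero (hF : HomogeneousIsotopy F) {s : ℝ} (hs : s ∈ Icc (0 : ℝ) 1)
    {v : EuclideanSpace ℂ (Fin 2)} (hv : v ≠ 0) : F s v ≠ 0 := fun h =>
  hv ((hF.bijective s hs).1 (h.trans (hF.map_zero s).symm))

theorem radial_map (hF : HomogeneousIsotopy F) (s : ℝ) {v : EuclideanSpace ℂ (Fin 2)}
    (hv : v ≠ 0) : radial (F s (radial v : S3)) = radial (F s v) := by
  rw [radial_coe hv, hF.smul s _ (inv_pos.mpr (norm_pos_iff.mpr hv)),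
    radial_smul (inv_pos.mpr (norm_pos_iff.mpr hv))]

/-- A bijection of `ℂ²` that commutes with positive scaling permutes the open rays from the origin,
and these are the points of the sphere. -/
theorem bijective_sphere (hF : HomogeneousIsotopy F) {s : ℝ} (hs : s ∈ Icc (0 : ℝ) 1) :
    Bijective fun u : S3 => radial (F s u) := by
  constructor
  · intro u v h
    obtain ⟨r, hr, h1⟩ := exists_smul_of_radial_eq (hF.ne_zero hs (sphere_ne_zero u))
      (hF.ne_zero hs (sphere_ne_zero v)) h
    rw [← hF.smul s r hr] at h1
    rw [← radial_sphere u, (hF.bijective s hs).1 h1, radial_smul hr, radial_sphere]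
  · intro u
    obtain ⟨v, hv⟩ := (hF.bijective s hs).2 u
    have hv0 : v ≠ 0 := by
      rintro rfl
      exact sphere_ne_zero u (by rw [← hv, hF.map_zero])
    exact ⟨radial v, by simp only [hF.radial_map s hv0, hv, radial_sphere]⟩

/-- The isotopy of the sphere induced by a homogeneous isotopy. -/
def sphereHomeo (hF : HomogeneousIsotopy F) (s : unitInterval) : S3 ≃ₜ S3 :=
  -- The sphere is compact and Hausdorff, so continuity of the inverse comes for free.
  Continuous.homeoOfEquivCompactToT2 (f := Equiv.ofBijective _ (hF.bijective_sphere s.2)) <| by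
    refine continuous_radial_comp (f := fun u : S3 => F s u) ?_
      fun u => hF.ne_zero s.2 (sphere_ne_zero u)
    exact hF.continuous.comp (Continuous.prodMk_right s)

theorem sphereHomeo_apply (hF : HomogeneousIsotopy F) (s : unitInterval) (u : S3) :
    hF.sphereHomeo s u = radial (F s u) := rfl

end HomogeneousIsotopy

/-- A curve that is carried to a torus knot by a homogeneous isotopy is a torus knot. -/
theorem IsTorusKnot.of_homogeneousIsotopy
    {F : ℝ → EuclideanSpace ℂ (Fin 2) → EuclideanSpace ℂ (Fin 2)} (hF : HomogeneousIsotopy F)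
    {p q : ℕ} {ξ : ℝ → EuclideanSpace ℂ (Fin 2)} (hξ : ∀ τ, ξ τ ≠ 0)
    (h : IsTorusKnot p q fun τ => radial (F 1 (ξ τ))) :
    IsTorusKnot p q fun τ => radial (ξ τ) := by
  have key : (fun τ => radial (F 1 (ξ τ))) = fun τ => hF.sphereHomeo 1 (radial (ξ τ)) := by
    funext τ
    rw [hF.sphereHomeo_apply, Set.Icc.coe_one, hF.radial_map 1 (hξ τ)]
  rw [key] at h
  obtain ⟨hc, ⟨T, hT, hper, hinj⟩, Φ, hΦ, hΦ0, hΦ1⟩ := h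
  -- The two isotopies are composed at equal times: the result is the identity at time 0, and at
  -- time 1 the given isotopy acts on the already deformed curve.
  refine ⟨?_, ⟨T, hT, ?_, ?_⟩, fun s => (hF.sphereHomeo s).trans (Φ s), ?_, ?_, ?_⟩
  · exact (hF.sphereHomeo 1).comp_continuous_iff.mp hc
  · exact fun τ => (hF.sphereHomeo 1).injective (hper τ)
  · exact fun a ha b hb hab => hinj ha hb (congrArg (hF.sphereHomeo 1) hab)
  · refine hΦ.comp (continuous_fst.prodMk (g := fun x => hF.sphereHomeo x.1 x.2) ?_)
    exact continuous_radial_comp hF.continuous fun x =>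
      hF.ne_zero x.1.2 (sphere_ne_zero x.2)
  · ext u : 1
    simp only [Homeomorph.trans_apply, hΦ0, hF.sphereHomeo_apply, Set.Icc.coe_zero,
      hF.zero, radial_sphere, Homeomorph.refl_apply, id]
  · rw [← hΦ1, ← Set.range_comp, ← Set.range_comp]
    rfl

/-! ### The standard torus knot -/

theorem pair_ne_zero {a b : ℂ} (ha : a ≠ 0) : (!₂[a, b] : EuclideanSpace ℂ (Fin 2)) ≠ 0 := by
  intro h
  exact ha (by simpa using congrArg (fun v : EuclideanSpace ℂ (Fin 2) => v 0) h)

theorem norm_unit_pair {a b : ℂ} (ha : ‖a‖ = 1) (hb : ‖b‖ = 1) :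
    ‖(!₂[a, b] : EuclideanSpace ℂ (Fin 2))‖ = √2 := by
  rw [EuclideanSpace.norm_eq]
  simp [ha, hb]
  norm_num

theorem real_smul_pair (r : ℝ) (a b : ℂ) :
    r • (!₂[a, b] : EuclideanSpace ℂ (Fin 2)) = !₂[r * a, r * b] := by
  ext i; fin_cases i <;> simp

theorem radial_unit_pair {a b : ℂ} (ha : ‖a‖ = 1) (hb : ‖b‖ = 1) :
    (radial !₂[a, b] : EuclideanSpace ℂ (Fin 2)) = !₂[a / (√2 : ℝ), b / (√2 : ℝ)] := by
  have h0 : a ≠ 0 := norm_ne_zero_iff.mp (by rw [ha]; exact one_ne_zero)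
  rw [radial_coe (pair_ne_zero h0), norm_unit_pair ha hb, real_smul_pair]
  push_cast
  simp only [div_eq_inv_mul]

theorem exp_ofReal_mul_I_eq_iff (a b : ℝ) :
    Complex.exp (a * Complex.I) = Complex.exp (b * Complex.I) ↔
      ∃ n : ℤ, a = b + n * (2 * Real.pi) := by
  rw [Complex.exp_eq_exp_iff_exists_int]
  refine exists_congr fun n => ?_
  rw [show (b : ℂ) * Complex.I + n * (2 * Real.pi * Complex.I) =
    ((b + n * (2 * Real.pi) : ℝ) : ℂ) * Complex.I by push_cast; ring]
  rw [mul_left_inj' Complex.I_ne_zero, Complex.ofReal_inj]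

/-- The linear flow of slope `(p, q)` on the Clifford torus is a torus knot. -/
theorem isTorusKnot_linear {p q : ℕ} (hpq : p.Coprime q) {ω : ℝ} (hω : ω ≠ 0) :
    IsTorusKnot p q fun τ => radial
      !₂[Complex.exp ((p * (ω * τ) : ℝ) * Complex.I),
         Complex.exp ((q * (ω * τ) : ℝ) * Complex.I)] := by
  have hne : ∀ x : ℝ, ‖Complex.exp (x * Complex.I)‖ = 1 := Complex.norm_exp_ofReal_mul_I
  have hκ := fun τ : ℝ => radial_unit_pair (hne (p * (ω * τ))) (hne (q * (ω * τ)))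
  have hs : ((√2 : ℝ) : ℂ) ≠ 0 := by simp
  have hpi := Real.pi_pos
  -- The image is already the standard knot, so the constant isotopy suffices. The absolute value
  -- allows flows that run backwards.
  refine ⟨?_, ⟨2 * Real.pi / |ω|, by positivity, ?_, ?_⟩, fun _ => Homeomorph.refl S3,
    continuous_snd, rfl, ?_⟩
  · refine continuous_radial_comp ?_ fun τ => pair_ne_zero (Complex.exp_ne_zero _)
    refine (PiLp.continuous_toLp 2 _).comp (continuous_pi fun i => ?_)
    fin_cases i <;> simp <;> fun_prop
  · intro τ
    have hp : ∀ r : ℕ, Complex.exp ((r * (ω * (τ + 2 * Real.pi / |ω|)) : ℝ) * Complex.I) =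
        Complex.exp ((r * (ω * τ) : ℝ) * Complex.I) := by
      intro r
      rw [exp_ofReal_mul_I_eq_iff]
      rcases lt_or_gt_of_ne hω with h | h
      · refine ⟨-r, ?_⟩
        rw [abs_of_neg h]
        push_cast
        field_simp
      · refine ⟨r, ?_⟩
        rw [abs_of_pos h]
        push_cast
        field_simp
    simp only [hp]
  · intro a ha b hb hab
    have h1 := congrArg (Subtype.val) hab
    simp only [hκ] at h1
    have e0 := congrArg (fun v : EuclideanSpace ℂ (Fin 2) => v 0) h1
    have e1 := congrArg (fun v : EuclideanSpace ℂ (Fin 2) => v 1) h1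
    simp only [Matrix.cons_val_zero, Matrix.cons_val_one,
      div_left_inj' hs] at e0 e1
    rw [exp_ofReal_mul_I_eq_iff] at e0 e1
    obtain ⟨m, hm⟩ := e0
    obtain ⟨n, hn⟩ := e1
    -- Bézout: equality of both coordinates makes `p ω (a - b)` and `q ω (a - b)` multiples of `2π`,
    -- hence also `ω (a - b)`. This excludes a shorter period.
    obtain ⟨x, y, hxy⟩ : ∃ x y : ℤ, (p : ℤ) * x + q * y = 1 :=
      ⟨_, _, by rw [← Nat.gcd_eq_gcd_ab, hpq.gcd_eq_one]; rfl⟩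
    have hxy' : (p : ℝ) * x + q * y = 1 := by exact_mod_cast hxy
    have hd : ω * (a - b) = ((x * m + y * n : ℤ) : ℝ) * (2 * Real.pi) := by
      push_cast
      linear_combination x * hm + y * hn - ω * (a - b) * hxy'
    have hlt : |a - b| < 2 * Real.pi / |ω| := by
      rw [abs_lt]; constructor <;> linarith [ha.1, ha.2, hb.1, hb.2]
    rw [lt_div_iff₀ (abs_pos.mpr hω), mul_comm, ← abs_mul, hd, abs_mul,
      abs_of_pos (by positivity : 0 < 2 * Real.pi)] at hlt
    have h3 : |((x * m + y * n : ℤ) : ℝ)| < 1 := by nlinarith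
    have h4 : x * m + y * n = 0 := by
      rw [← Int.cast_abs] at h3
      exact Int.abs_lt_one_iff.mp (by exact_mod_cast h3)
    rw [h4] at hd
    have := mul_eq_zero.mp (hd.trans (by simp))
    rcases this with h | h
    · exact absurd h hω
    · linarith
  · ext u
    rw [show ((Homeomorph.refl S3 : S3 ≃ₜ S3) : S3 → S3) = id from rfl, image_id]
    simp only [torusKnot, mem_range, mem_ofPred_eq]
    constructor
    · rintro ⟨τ, rfl⟩
      refine ⟨ω * τ, ?_⟩
      rw [hκ]
      push_cast
      rfl
    · rintro ⟨θ, hθ⟩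
      refine ⟨θ / ω, Subtype.ext ?_⟩
      rw [hκ, hθ, mul_div_cancel₀ _ hω]
      push_cast
      rfl

/-! ### Isotopies of the plane -/

/-- A continuous path of bijections of the plane starting at the identity that are positively
homogeneous of degree one. -/
structure PlanarIsotopy (Ψ : ℝ → ℂ → ℂ) : Prop where
  continuous : Continuous fun x : ℝ × ℂ => Ψ x.1 x.2
  bijective : ∀ s ∈ Icc (0 : ℝ) 1, Bijective (Ψ s)
  smul : ∀ (s r : ℝ), 0 < r → ∀ v, Ψ s (r * v) = r * Ψ s v
  zero : ∀ v, Ψ 0 v = v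

theorem PlanarIsotopy.prod {Ψ₁ Ψ₂ : ℝ → ℂ → ℂ} (h₁ : PlanarIsotopy Ψ₁) (h₂ : PlanarIsotopy Ψ₂) :
    HomogeneousIsotopy fun s v => !₂[Ψ₁ s (v 0), Ψ₂ s (v 1)] where
  continuous := by
    refine (PiLp.continuous_toLp 2 _).comp (continuous_pi fun i => ?_)
    have hc : ∀ j : Fin 2, Continuous fun x : unitInterval × S3 =>
        ((x.1 : ℝ), (x.2 : EuclideanSpace ℂ (Fin 2)) j) := fun j => by fun_prop
    fin_cases i
    · exact h₁.continuous.comp (hc 0)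
    · exact h₂.continuous.comp (hc 1)
  bijective := by
    intro s hs
    constructor
    · intro v w h
      have e0 := congrArg (fun v : EuclideanSpace ℂ (Fin 2) => v 0) h
      have e1 := congrArg (fun v : EuclideanSpace ℂ (Fin 2) => v 1) h
      simp only [Matrix.cons_val_zero, Matrix.cons_val_one] at e0 e1
      ext i
      fin_cases i
      · exact (h₁.bijective s hs).1 e0
      · exact (h₂.bijective s hs).1 e1
    · intro v
      obtain ⟨a, ha⟩ := (h₁.bijective s hs).2 (v 0)
      obtain ⟨b, hb⟩ := (h₂.bijective s hs).2 (v 1)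
      refine ⟨!₂[a, b], ?_⟩
      ext i
      fin_cases i <;> simp [ha, hb]
  smul := by
    intro s r hr v
    rw [real_smul_pair, ← h₁.smul s r hr, ← h₂.smul s r hr]
    simp
  zero := by
    intro v
    ext i
    fin_cases i <;> simp [h₁.zero, h₂.zero]

/-- A continuous function that increases by `c > 0` after every step `T` is surjective. -/
theorem surjective_of_quasiperiodic {g : ℝ → ℝ} (hg : Continuous g) {T c : ℝ} (hc : 0 < c)
    (h : ∀ x, g (x + T) = g x + c) : Surjective g := by
  have hn : ∀ n : ℕ, g (n * T) = g 0 + n * c ∧ g (-(n * T)) = g 0 - n * c := by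
    intro n
    induction n with
    | zero => simp
    | succ n ih =>
      constructor
      · have := h (n * T)
        push_cast
        rw [show ((n : ℝ) + 1) * T = n * T + T by ring, this, ih.1]; ring
      · have := h (-((n + 1 : ℕ) * T))
        rw [show -(((n + 1 : ℕ) : ℝ) * T) + T = -(n * T) by push_cast; ring, ih.2] at this
        push_cast at this ⊢
        linarith
  intro y
  apply mem_range_of_exists_le_of_exists_ge hg
  · obtain ⟨n, hn'⟩ := exists_nat_ge ((g 0 - y) / c)
    rw [div_le_iff₀ hc] at hn'
    exact ⟨_, by rw [(hn n).2]; linarith⟩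
  · obtain ⟨n, hn'⟩ := exists_nat_ge ((y - g 0) / c)
    rw [div_le_iff₀ hc] at hn'
    exact ⟨_, by rw [(hn n).1]; linarith⟩

/-- The path of maps `v ↦ exp (s h (arg v)) v` of the plane. -/
def angularIsotopy (h : Real.Angle → ℂ) (s : ℝ) (v : ℂ) : ℂ :=
  v * Complex.exp (s * h (Complex.arg v : Real.Angle))

theorem angularIsotopy_exp (h : Real.Angle → ℂ) (s : ℝ) (x : ℂ) :
    angularIsotopy h s (Complex.exp x) = Complex.exp (x + s * h (x.im : Real.Angle)) := by
  have harg : ((Complex.exp x).arg : Real.Angle) = x.im := by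
    rw [Complex.arg_exp, Real.Angle.coe_toIocMod]
  rw [angularIsotopy, harg, Complex.exp_add]

theorem angularIsotopy_zero (h : Real.Angle → ℂ) (s : ℝ) : angularIsotopy h s 0 = 0 := by
  simp [angularIsotopy]

/-- In logarithmic coordinates the map is `x ↦ x + s h(Im x)`, a shear over the angle. It is
therefore bijective as soon as its action on angles is. At the origin, continuity follows from the
boundedness of `h` on the compact circle. -/
theorem planarIsotopy_angularIsotopy {h : Real.Angle → ℂ} (hc : Continuous h)
    (hmono : StrictMono fun φ : ℝ => φ + (h φ).im) : PlanarIsotopy (angularIsotopy h) where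
  continuous := by
    obtain ⟨C, hC⟩ : ∃ C, ∀ a, ‖h a‖ ≤ C := by
      have : Fact (0 < 2 * Real.pi) := ⟨Real.two_pi_pos⟩
      have : CompactSpace Real.Angle := inferInstanceAs (CompactSpace (AddCircle (2 * Real.pi)))
      obtain ⟨C, hC⟩ := (isCompact_range hc).isBounded.exists_norm_le
      exact ⟨C, fun a => hC _ ⟨a, rfl⟩⟩
    rw [continuous_iff_continuousAt]
    rintro ⟨s, v⟩
    by_cases hv : v = 0
    · subst hv
      rw [ContinuousAt, angularIsotopy_zero]
      apply squeeze_zero_norm (a := fun x : ℝ × ℂ => ‖x.2‖ * Real.exp (|x.1| * C))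
      · intro x
        rw [angularIsotopy, norm_mul, Complex.norm_exp]
        gcongr
        calc _ ≤ ‖(x.1 : ℂ) * h (Complex.arg x.2 : Real.Angle)‖ := Complex.re_le_norm _
          _ ≤ _ := by
            rw [norm_mul, Complex.norm_real, Real.norm_eq_abs]
            gcongr
            exact hC _
      · have : Continuous fun x : ℝ × ℂ => ‖x.2‖ * Real.exp (|x.1| * C) := by fun_prop
        simpa using this.tendsto (s, 0)
    · have h1 : ContinuousAt (fun x : ℝ × ℂ => (Complex.arg x.2 : Real.Angle)) (s, v) :=
        ContinuousAt.comp (g := fun w : ℂ => (Complex.arg w : Real.Angle)) (x := (s, v))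
          (Complex.continuousAt_arg_coe_angle hv) continuousAt_snd
      have h2 := hc.continuousAt.comp h1
      exact continuousAt_snd.mul (((Complex.continuous_ofReal.continuousAt.comp
        continuousAt_fst).mul h2).cexp)
  bijective := by
    intro s hs
    -- The function is the convex combination of `φ` and `φ + Im h(φ)` with weights `1 - s` and `s`.
    have hg : StrictMono fun φ : ℝ => φ + s * (h φ).im := by
      intro a b hab
      have := hmono hab
      simp only at this ⊢
      rcases hs.2.eq_or_lt with rfl | hs1
      · linarith
      · nlinarith [hs.1]
    have hper : ∀ (x : ℂ) (n : ℤ),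
        h ((x + n * (2 * Real.pi * Complex.I)).im : ℝ) = h (x.im : Real.Angle) := by
      intro x n
      congr 1
      rw [Real.Angle.angle_eq_iff_two_pi_dvd_sub]
      exact ⟨n, by simp [mul_comm]⟩
    constructor
    · intro v w hvw
      by_cases hv : v = 0
      · subst hv
        rw [angularIsotopy_zero, angularIsotopy] at hvw
        exact ((mul_eq_zero.mp hvw.symm).resolve_right (Complex.exp_ne_zero _)).symm
      by_cases hw : w = 0
      · subst hw
        rw [angularIsotopy_zero, angularIsotopy] at hvw
        exact (mul_eq_zero.mp hvw).resolve_right (Complex.exp_ne_zero _)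
      rw [← Complex.exp_log hv, ← Complex.exp_log hw] at hvw ⊢
      generalize Complex.log v = x at hvw ⊢
      generalize Complex.log w = y at hvw ⊢
      rw [angularIsotopy_exp, angularIsotopy_exp, Complex.exp_eq_exp_iff_exists_int] at hvw
      obtain ⟨n, hn⟩ := hvw
      rw [Complex.exp_eq_exp_iff_exists_int]
      refine ⟨n, ?_⟩
      -- The multiple of `2πi` is absorbed into the logarithm `y`, which does not change the angle
      -- at which `h` is evaluated.
      rw [add_right_comm, ← hper y n] at hn
      generalize y + n * (2 * Real.pi * Complex.I) = y' at hn ⊢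
      have him : x.im = y'.im := by
        apply hg.injective
        simpa using congrArg Complex.im hn
      rw [him] at hn
      exact add_right_cancel hn
    · intro v
      by_cases hv : v = 0
      · exact ⟨0, by rw [angularIsotopy_zero, hv]⟩
      have hsurj : Surjective fun φ : ℝ => φ + s * (h φ).im := by
        apply surjective_of_quasiperiodic (T := 2 * Real.pi) (c := 2 * Real.pi) _
          Real.two_pi_pos
        · intro φ
          simp only [Real.Angle.coe_add, Real.Angle.coe_two_pi, add_zero]
          ring
        · exact continuous_id.add (continuous_const.mul
            (Complex.continuous_im.comp (hc.comp Real.Angle.continuous_coe)))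
      obtain ⟨φ, hφ⟩ := hsurj (Complex.log v).im
      simp only at hφ
      refine ⟨Complex.exp (Complex.log v - s * h φ), ?_⟩
      rw [angularIsotopy_exp]
      have : (Complex.log v - s * h φ).im = φ := by
        rw [Complex.sub_im, Complex.im_ofReal_mul, ← hφ]; ring
      rw [this, sub_add_cancel, Complex.exp_log hv]
  smul := by
    intro s r hr v
    rw [angularIsotopy, angularIsotopy, Complex.arg_real_mul v hr, mul_assoc]
  zero := by
    intro v
    simp [angularIsotopy]

/-- Multiplication by the complex numbers `exp (s a)` is an isotopy of the plane. -/
theorem planarIsotopy_exp_mul (a : ℂ) : PlanarIsotopy fun s v => v * Complex.exp (s * a) :=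
  planarIsotopy_angularIsotopy (h := fun _ => a) continuous_const
    fun _ _ hxy => by simpa using hxy

/-- `ℓ` is a logarithm of a closed curve of period `T` that winds once around the origin, with
strictly increasing argument. -/
structure IsWindingLog (ℓ : ℝ → ℂ) (T : ℝ) : Prop where
  continuous : Continuous ℓ
  strictMono : StrictMono fun τ => (ℓ τ).im
  pos : 0 < T
  add_period : ∀ τ, ℓ (τ + T) = ℓ τ + 2 * Real.pi * Complex.I

/-- A closed curve that winds once around the origin with strictly increasing argument can be
carried to the uniformly parametrized unit circle. -/
theorem IsWindingLog.exists_planarIsotopy {ℓ : ℝ → ℂ} {T : ℝ} (hℓ : IsWindingLog ℓ T) :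
    ∃ Ψ, PlanarIsotopy Ψ ∧
      ∀ τ, Ψ 1 (Complex.exp (ℓ τ)) = Complex.exp ((2 * Real.pi / T * τ : ℝ) * Complex.I) := by
  have hT := hℓ.pos
  have hsurj : Surjective fun τ => (ℓ τ).im :=
    surjective_of_quasiperiodic (T := T) (c := 2 * Real.pi)
      (Complex.continuous_im.comp hℓ.continuous) Real.two_pi_pos
      fun τ => by rw [hℓ.add_period]; simp
  let θ : ℝ ≃o ℝ := hℓ.strictMono.orderIsoOfSurjective _ hsurj
  have hθ : ∀ τ, θ τ = (ℓ τ).im := fun τ => rfl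
  have hθ' : ∀ φ, (ℓ (θ.symm φ)).im = φ := fun φ => θ.apply_symm_apply φ
  -- The logarithmic displacement from the point of the curve at angle `φ` to its target on the
  -- circle. The new angle is then `2π/T` times the time `θ.symm φ`, which is increasing in `φ`.
  let g : ℝ → ℂ := fun φ =>
    -ℓ (θ.symm φ) + (2 * Real.pi / T * θ.symm φ : ℝ) * Complex.I
  have hshift : ∀ φ, θ.symm (φ + 2 * Real.pi) = θ.symm φ + T := by
    intro φ
    rw [OrderIso.symm_apply_eq, hθ, hℓ.add_period, Complex.add_im, hθ']
    simp
  have hgper : Periodic g (2 * Real.pi) := by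
    intro φ
    simp only [g, hshift, hℓ.add_period]
    push_cast
    have : (T : ℂ) ≠ 0 := by exact_mod_cast hT.ne'
    field_simp
    ring
  have hgc : Continuous g := by
    have : Continuous θ.symm := θ.symm.continuous
    exact (hℓ.continuous.comp this).neg.add (by fun_prop)
  let h : Real.Angle → ℂ := hgper.lift
  have hh : ∀ φ : ℝ, h φ = g φ := fun φ => hgper.lift_coe φ
  have hhc : Continuous h := by
    apply continuous_coinduced_dom.mpr
    exact hgc
  refine ⟨angularIsotopy h, planarIsotopy_angularIsotopy hhc ?_, fun τ => ?_⟩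
  · intro a b hab
    have : θ.symm a < θ.symm b := θ.symm.strictMono hab
    simp only [hh, g, Complex.add_im, Complex.neg_im, hθ', 
      Complex.im_ofReal_mul, Complex.I_im, mul_one]
    have h2 : 0 < 2 * Real.pi / T := div_pos Real.two_pi_pos hT
    have := mul_lt_mul_of_pos_left this h2
    linarith
  · rw [angularIsotopy_exp, hh]
    have : θ.symm (ℓ τ).im = τ := θ.symm_apply_apply τ
    simp only [g, this]
    congr 1
    push_cast
    ring

/-- Two curves of the phase plane that wind once clockwise around the origin in times whose ratio is
`k : l` are the components of a torus knot. -/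
theorem isTorusKnot_of_windingLogs {k l : ℕ} (hk : 0 < k) (hl : 0 < l) (hkl : k.Coprime l)
    {ℓ₁ ℓ₂ : ℝ → ℂ} {T₁ T₂ : ℝ} (h₁ : IsWindingLog (fun τ => ℓ₁ (-τ)) T₁)
    (h₂ : IsWindingLog (fun τ => ℓ₂ (-τ)) T₂) (hT : T₂ / T₁ = (k : ℝ) / l) :
    IsTorusKnot k l fun τ => radial !₂[Complex.exp (ℓ₁ τ), Complex.exp (ℓ₂ τ)] := by
  obtain ⟨Ψ₁, hΨ₁, e₁⟩ := h₁.exists_planarIsotopy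
  obtain ⟨Ψ₂, hΨ₂, e₂⟩ := h₂.exists_planarIsotopy
  have hp₁ := h₁.pos
  have hp₂ := h₂.pos
  have hk' : (0 : ℝ) < k := by exact_mod_cast hk
  have hl' : (0 : ℝ) < l := by exact_mod_cast hl
  rw [div_eq_div_iff hp₁.ne' hl'.ne'] at hT
  refine IsTorusKnot.of_homogeneousIsotopy (hΨ₁.prod hΨ₂)
    (fun τ => pair_ne_zero (Complex.exp_ne_zero _)) ?_
  have hpi := Real.pi_pos
  -- Since `l T₂ = k T₁`, this number is the common time in which the first circle is run through
  -- `k` times and the second `l` times. The minus sign records the clockwise direction.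
  have hω : -(2 * Real.pi / (k * T₁)) ≠ 0 := by
    have : 0 < 2 * Real.pi / (k * T₁) := by positivity
    linarith
  convert isTorusKnot_linear hkl hω using 6 with τ
  · have := e₁ (-τ)
    rw [neg_neg] at this
    simp only [Matrix.cons_val_zero]
    rw [this]
    congr 3
    field_simp
  · have := e₂ (-τ)
    rw [neg_neg] at this
    simp only [Matrix.cons_val_one, Matrix.cons_val_zero]
    rw [this]
    congr 3
    rw [← hT]
    field_simp

/-! ### One degree of freedom -/

/-- Solutions of `x' = 4 p`, `p' = - f x` that stay bounded are determined by their initial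
values. -/
theorem newton_unique {f : ℝ → ℝ} (hf : ContDiff ℝ 1 f) {x p x' p' : ℝ → ℝ}
    (hx : ∀ τ, HasDerivAt x (4 * p τ) τ) (hp : ∀ τ, HasDerivAt p (-f (x τ)) τ)
    (hx' : ∀ τ, HasDerivAt x' (4 * p' τ) τ) (hp' : ∀ τ, HasDerivAt p' (-f (x' τ)) τ)
    (hb : Bornology.IsBounded (range fun τ => (x τ, p τ)))
    (hb' : Bornology.IsBounded (range fun τ => (x' τ, p' τ)))
    (h0 : (x 0, p 0) = (x' 0, p' 0)) (τ : ℝ) : (x τ, p τ) = (x' τ, p' τ) := by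
  -- Both solutions stay in one closed ball, on which the `C¹` vector field is Lipschitz.
  obtain ⟨R, hR⟩ := (hb.union hb').subset_closedBall (0 : ℝ × ℝ)
  have hv : ContDiff ℝ 1 fun y : ℝ × ℝ => (4 * y.2, -f y.1) :=
    (contDiff_const.mul contDiff_snd).prodMk (hf.comp contDiff_fst).neg
  obtain ⟨K, hK⟩ := hv.contDiffOn.exists_lipschitzOnWith one_ne_zero
    (convex_closedBall (0 : ℝ × ℝ) R) (isCompact_closedBall _ _)
  exact congrFun (ODE_solution_unique_univ (v := fun _ y => (4 * y.2, -f y.1))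
    (s := fun _ => Metric.closedBall 0 R) (f := fun τ => (x τ, p τ))
    (g := fun τ => (x' τ, p' τ)) (fun _ => hK)
    (fun t => ⟨(hx t).prodMk (hp t), hR (Or.inl ⟨t, rfl⟩)⟩)
    (fun t => ⟨(hx' t).prodMk (hp' t), hR (Or.inr ⟨t, rfl⟩)⟩) h0) τ

/-- In a potential well the energy increases along rays. -/
theorem energy_lt_of_ray {f W : ℝ → ℝ} (hW : ∀ u, HasDerivAt W (f u) u) {S : Set ℝ}
    (hS : ∀ u ∈ S, ∀ r ∈ Icc (0 : ℝ) 1, r * u ∈ S) (hpos : ∀ u ∈ S, u ≠ 0 → 0 < u * f u)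
    {a b r : ℝ} (ha : a ∈ S) (hab : a ≠ 0 ∨ b ≠ 0) (hr0 : 0 < r) (hr1 : r < 1) :
    2 * (r * b) ^ 2 + W (r * a) < 2 * b ^ 2 + W a := by
  have hd : ∀ s : ℝ, HasDerivAt (fun s => 2 * (s * b) ^ 2 + W (s * a))
      (4 * (s * b) * b + f (s * a) * a) s := by
    intro s
    have h1 := (((hasDerivAt_id s).mul_const b).pow 2).const_mul 2
    have h2 := (hW (s * a)).comp s ((hasDerivAt_id s).mul_const a)
    refine (h1.add h2).congr_deriv ?_
    simp
    ring
  have hm : StrictMonoOn (fun s => 2 * (s * b) ^ 2 + W (s * a)) (Icc 0 1) := by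
    refine strictMonoOn_of_deriv_pos (convex_Icc 0 1)
      (fun s _ => (hd s).continuousAt.continuousWithinAt) fun s hs => ?_
    rw [interior_Icc] at hs
    rw [(hd s).deriv]
    by_cases h : a = 0
    · have hb : b ≠ 0 := hab.resolve_left (not_not.mpr h)
      have : 0 < s * b ^ 2 := mul_pos hs.1 (by positivity)
      rw [h]
      nlinarith
    · have h1 := hpos (s * a) (hS a ha s ⟨hs.1.le, hs.2.le⟩) (mul_ne_zero hs.1.ne' h)
      have h2 : 0 < s * (f (s * a) * a) := by linarith
      have h3 := pos_of_mul_pos_right h2 hs.1.le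
      have : 0 ≤ s * b ^ 2 := mul_nonneg hs.1.le (sq_nonneg b)
      nlinarith
  simpa using hm ⟨hr0.le, hr1.le⟩ ⟨zero_le_one, le_rfl⟩ hr1

theorem not_const_of_isMinimalPeriod {α : Type*} {g : ℝ → α} {T : ℝ} (h : IsMinimalPeriod g T)
    {a : α} (ha : ∀ τ, g τ = a) : False := by
  have := h.2.2 (T / 2) (half_pos h.1) fun τ => by rw [ha, ha]
  linarith [h.1]

/-- A nonconstant periodic orbit in a potential well winds clockwise around the origin of the phase
plane, once in its minimal period. -/
theorem exists_windingLog {f W : ℝ → ℝ} (hf : ContDiff ℝ 1 f) (hf0 : f 0 = 0)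
    (hW : ∀ u, HasDerivAt W (f u) u) {S : Set ℝ}
    (hS : ∀ u ∈ S, ∀ r ∈ Icc (0 : ℝ) 1, r * u ∈ S) (hpos : ∀ u ∈ S, u ≠ 0 → 0 < u * f u)
    {x p : ℝ → ℝ} (hx : ∀ τ, HasDerivAt x (4 * p τ) τ) (hp : ∀ τ, HasDerivAt p (-f (x τ)) τ)
    (hxS : ∀ τ, x τ ∈ S) {T : ℝ} (hT : IsMinimalPeriod (fun τ => (x τ, p τ)) T) :
    ∃ ℓ : ℝ → ℂ, IsWindingLog (fun τ => ℓ (-τ)) T ∧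
      ∀ τ, Complex.exp (ℓ τ) = ⟨x τ, p τ⟩ := by
  obtain ⟨hT0, hper, hmin⟩ := id hT
  have hxc : Continuous x := continuous_iff_continuousAt.mpr fun τ => (hx τ).continuousAt
  have hpc : Continuous p := continuous_iff_continuousAt.mpr fun τ => (hp τ).continuousAt
  have hb : Bornology.IsBounded (range fun τ => (x τ, p τ)) :=
    hper.isBounded_of_continuous hT0.ne' (hxc.prodMk hpc)
  have hshift : ∀ (s : ℝ) {g g' : ℝ → ℝ}, (∀ τ, HasDerivAt g (g' τ) τ) →
      ∀ τ, HasDerivAt (fun τ => g (τ + s)) (g' (τ + s)) τ :=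
    fun s g g' hg τ => HasDerivAt.comp_add_const τ s (hg (τ + s))
  have hbs : ∀ s, Bornology.IsBounded (range fun τ => (x (τ + s), p (τ + s))) :=
    fun s => hb.subset (by rintro _ ⟨τ, rfl⟩; exact ⟨τ + s, rfl⟩)
  -- The origin is an equilibrium, so an orbit that meets it is constant by uniqueness, and a
  -- constant has no minimal period.
  have hne : ∀ τ, x τ ≠ 0 ∨ p τ ≠ 0 := by
    intro s
    by_contra! h
    have h0 : ∀ τ, (x (τ + s), p (τ + s)) = ((0 : ℝ), (0 : ℝ)) :=
      newton_unique hf (x' := fun _ => 0) (p' := fun _ => 0) (hshift s hx) (hshift s hp)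
        (fun τ => by simpa using hasDerivAt_const τ (0 : ℝ))
        (fun τ => by simpa [hf0] using hasDerivAt_const τ (0 : ℝ)) (hbs s)
        (by simp) (by simp [h.1, h.2])
    exact not_const_of_isMinimalPeriod hT (a := (0, 0)) fun τ => by
      simpa using h0 (τ - s)
  let ζ : ℝ → ℂ := fun τ => x τ + p τ * Complex.I
  have hζ : ∀ τ, ζ τ = ⟨x τ, p τ⟩ := fun τ => by apply Complex.ext <;> simp [ζ]
  have hζ0 : ∀ τ, ζ τ ≠ 0 := by
    intro τ h
    rw [hζ, Complex.ext_iff] at h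
    rcases hne τ with h' | h'
    · exact h' h.1
    · exact h' h.2
  -- This is the logarithmic derivative `ζ'/ζ`. Its integral gives a continuous logarithm of the
  -- curve.
  let q : ℝ → ℂ := fun τ => ((4 * p τ : ℝ) + (-f (x τ) : ℝ) * Complex.I) / ζ τ
  have hζd : ∀ τ, HasDerivAt ζ (q τ * ζ τ) τ := by
    intro τ
    rw [div_mul_cancel₀ _ (hζ0 τ)]
    exact (hx τ).ofReal_comp.add ((hp τ).ofReal_comp.mul_const _)
  have hqc : Continuous q := by
    have h1 := hf.continuous.comp hxc
    refine Continuous.div ?_ (by fun_prop) hζ0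
    exact (Complex.continuous_ofReal.comp (continuous_const.mul hpc)).add
      ((Complex.continuous_ofReal.comp h1.neg).mul continuous_const)
  let ℓ : ℝ → ℂ := fun τ => Complex.log (ζ 0) + ∫ u in (0 : ℝ)..τ, q u
  have hℓd : ∀ τ, HasDerivAt ℓ (q τ) τ := fun τ =>
    (hqc.integral_hasStrictDerivAt 0 τ).hasDerivAt.const_add _
  have hℓc : Continuous ℓ := continuous_iff_continuousAt.mpr fun τ => (hℓd τ).continuousAt
  have hexp : ∀ τ, Complex.exp (ℓ τ) = ζ τ := by
    have hd : ∀ τ, HasDerivAt (fun τ => ζ τ * Complex.exp (-ℓ τ)) 0 τ := by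
      intro τ
      refine ((hζd τ).mul (hℓd τ).neg.cexp).congr_deriv ?_
      ring
    have hc := is_const_of_deriv_eq_zero (fun τ => (hd τ).differentiableAt)
      fun τ => (hd τ).deriv
    intro τ
    have h1 := hc τ 0
    have h2 : ℓ 0 = Complex.log (ζ 0) := by simp [ℓ]
    rw [h2, Complex.exp_neg, Complex.exp_neg, Complex.exp_log (hζ0 0), mul_inv_cancel₀ (hζ0 0),
      mul_inv_eq_one₀ (Complex.exp_ne_zero _)] at h1
    exact h1.symm
  -- The angular velocity is `-(4p² + x f(x))/|ζ|²`, negative because the force points towards the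
  -- center of the well.
  have hqim : ∀ τ, (q τ).im < 0 := by
    intro τ
    have hn : 0 < Complex.normSq (ζ τ) := Complex.normSq_pos.mpr (hζ0 τ)
    have : (q τ).im = -(4 * p τ ^ 2 + x τ * f (x τ)) / Complex.normSq (ζ τ) := by
      simp only [q, Complex.div_im]
      simp [ζ]
      ring
    rw [this]
    refine div_neg_of_neg_of_pos ?_ hn
    by_cases h : x τ = 0
    · have hb : p τ ≠ 0 := (hne τ).resolve_left (not_not.mpr h)
      have : 0 < p τ ^ 2 := by positivity
      rw [h]; linarith
    · have := hpos _ (hxS τ) h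
      nlinarith [sq_nonneg (p τ)]
  have hanti : StrictAnti fun τ => (ℓ τ).im := by
    have hd : ∀ τ, HasDerivAt (fun τ => (ℓ τ).im) (q τ).im τ := fun τ =>
      Complex.imCLM.hasFDerivAt.comp_hasDerivAt τ (hℓd τ)
    exact strictAnti_of_deriv_neg fun τ => by rw [(hd τ).deriv]; exact hqim τ
  have hqper : ∀ τ, q (τ + T) = q τ := by
    intro τ
    have := hper τ
    simp only [Prod.mk.injEq] at this
    simp only [q, ζ, this.1, this.2]
  have hadd : ∀ τ, ℓ (τ + T) - ℓ τ = ℓ (0 + T) - ℓ 0 := by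
    have hd : ∀ τ, HasDerivAt (fun τ => ℓ (τ + T) - ℓ τ) 0 τ := by
      intro τ
      refine ((HasDerivAt.comp_add_const τ T (hℓd (τ + T))).sub (hℓd τ)).congr_deriv ?_
      rw [hqper, sub_self]
    exact fun τ => is_const_of_deriv_eq_zero (fun τ => (hd τ).differentiableAt)
      (fun τ => (hd τ).deriv) τ 0
  obtain ⟨n, hn⟩ : ∃ n : ℤ, ℓ T = ℓ 0 + n * (2 * Real.pi * Complex.I) := by
    rw [← Complex.exp_eq_exp_iff_exists_int, hexp, hexp, hζ, hζ]
    have := hper 0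
    simp only [zero_add, Prod.mk.injEq] at this
    rw [this.1, this.2]
  have hnim : (ℓ T).im = (ℓ 0).im + n * (2 * Real.pi) := by rw [hn]; simp
  have hn1 : n ≤ -1 := by
    have h1 := hanti hT0
    simp only at h1
    have h2 : (n : ℝ) < 0 := by
      by_contra! h
      nlinarith [Real.pi_pos]
    have : n < 0 := by exact_mod_cast h2
    omega
  have hpi := Real.pi_pos
  -- At the time `σ` of one full clockwise turn the curve is back on its initial ray. Energy is
  -- strictly increasing along rays, so it is back at its initial point, and minimality of `T`
  -- forces `σ = T`.
  obtain ⟨σ, hσ, hσim⟩ : ∃ σ ∈ Icc 0 T, (ℓ σ).im = (ℓ 0).im - 2 * Real.pi := by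
    have h1 : (n : ℝ) ≤ -1 := by exact_mod_cast hn1
    exact intermediate_value_Icc' hT0.le (Complex.continuous_im.comp hℓc).continuousOn
      ⟨by change (ℓ T).im ≤ _; nlinarith, by change _ ≤ (ℓ 0).im; linarith⟩
  have hσ0 : 0 < σ := by
    rcases hσ.1.eq_or_lt with h | h
    · rw [← h] at hσim; linarith
    · exact h
  obtain ⟨r, hr, hrσ⟩ : ∃ r : ℝ, 0 < r ∧ ζ σ = r * ζ 0 := by
    refine ⟨Real.exp ((ℓ σ).re - (ℓ 0).re), Real.exp_pos _, ?_⟩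
    rw [← hexp, ← hexp, Complex.ofReal_exp, ← Complex.exp_add, Complex.exp_eq_exp_iff_exists_int]
    refine ⟨-1, Complex.ext ?_ ?_⟩
    · simp
    · simp [hσim]; ring
  have hrx : x σ = r * x 0 := by simpa [ζ] using congrArg Complex.re hrσ
  have hrp : p σ = r * p 0 := by simpa [ζ] using congrArg Complex.im hrσ
  have henergy : 2 * p σ ^ 2 + W (x σ) = 2 * p 0 ^ 2 + W (x 0) := by
    have hd : ∀ τ, HasDerivAt (fun τ => 2 * p τ ^ 2 + W (x τ)) 0 τ := by
      intro τ
      refine ((((hp τ).pow 2).const_mul 2).add ((hW (x τ)).comp τ (hx τ))).congr_deriv ?_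
      simp
      ring
    exact is_const_of_deriv_eq_zero (fun τ => (hd τ).differentiableAt)
      (fun τ => (hd τ).deriv) σ 0
  have hr1 : r = 1 := by
    rcases lt_trichotomy r 1 with h | h | h
    · have := energy_lt_of_ray hW hS hpos (hxS 0) (hne 0) hr h
      rw [← hrx, ← hrp] at this
      linarith
    · exact h
    -- For `r > 1` the roles are exchanged: the initial point lies on the ray between the origin and
    -- the point at time `σ`, so star-shapedness of `S` applies again.
    · have := energy_lt_of_ray hW hS hpos (hxS σ) (hne σ) (inv_pos.mpr hr) (inv_lt_one_of_one_lt₀ h)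
      rw [hrx, hrp, inv_mul_cancel_left₀ hr.ne', inv_mul_cancel_left₀ hr.ne', ← hrx, ← hrp] at this
      linarith
  have hσT : σ = T := by
    refine le_antisymm hσ.2 (hmin σ hσ0 ?_)
    intro τ
    exact newton_unique hf (x := fun τ => x (τ + σ)) (p := fun τ => p (τ + σ)) (hshift σ hx)
      (hshift σ hp) hx hp (hbs σ) hb
      (by simp [hrx, hrp, hr1]) τ
  have hn' : n = -1 := by
    rw [hσT, hnim] at hσim
    have : (n : ℝ) * (2 * Real.pi) = (-1 : ℤ) * (2 * Real.pi) := by push_cast; linarith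
    exact_mod_cast mul_right_cancel₀ (by positivity) this
  refine ⟨ℓ, ⟨hℓc.comp continuous_neg, fun a b hab => hanti (neg_lt_neg hab), hT0, fun τ => ?_⟩,
    fun τ => by rw [hexp, hζ]⟩
  have h1 := hadd (-(τ + T))
  rw [zero_add, hn, hn', show -(τ + T) + T = -τ by ring] at h1
  push_cast at h1
  linear_combination -h1

/-! ### Gradients for the real inner product of the complex plane -/

theorem gradient_eq_of_hasFDerivAt {f : ℂ → ℝ} {L : ℂ →L[ℝ] ℝ} {u : ℂ}
    (h : HasFDerivAt f L u) : gradient f u = ⟨L 1, L Complex.I⟩ := by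
  have key : ∀ v, inner ℝ (gradient f u) v = L v := by
    intro v
    rw [gradient, InnerProductSpace.toDual_symm_apply, h.fderiv]
  apply Complex.ext
  · have := key 1
    rw [Complex.inner] at this
    simpa using this
  · have := key Complex.I
    rw [Complex.inner] at this
    simpa using this

theorem gradient_add_re_im {g h : ℝ → ℝ} {a b : ℝ} {u : ℂ} (hg : HasDerivAt g a u.re)
    (hh : HasDerivAt h b u.im) : gradient (fun v : ℂ => g v.re + h v.im) u = ⟨a, b⟩ := by
  have h1 : HasFDerivAt (fun v : ℂ => g v.re + h v.im)
      (a • Complex.reCLM + b • Complex.imCLM) u :=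
    (hg.comp_hasFDerivAt u Complex.reCLM.hasFDerivAt).add
      (hh.comp_hasFDerivAt u Complex.imCLM.hasFDerivAt)
  rw [gradient_eq_of_hasFDerivAt h1]
  simp

theorem hasDerivAt_re {g : ℝ → ℂ} {g' : ℂ} {τ : ℝ} (h : HasDerivAt g g' τ) :
    HasDerivAt (fun τ => (g τ).re) g'.re τ :=
  Complex.reCLM.hasFDerivAt.comp_hasDerivAt τ h

theorem hasDerivAt_im {g : ℝ → ℂ} {g' : ℂ} {τ : ℝ} (h : HasDerivAt g g' τ) :
    HasDerivAt (fun τ => (g τ).im) g'.im τ :=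
  Complex.imCLM.hasFDerivAt.comp_hasDerivAt τ h

/-! ### The Euler problem -/

theorem gradient_eulerReg_momentum (μ c : ℝ) (Q P : ℂ) :
    gradient (fun v => eulerReg μ c Q v) P = ⟨4 * P.re, 4 * P.im⟩ := by
  have hg : ∀ k x : ℝ, HasDerivAt (fun x => 2 * x ^ 2 + k) (4 * x) x := fun k x => by
    refine (((hasDerivAt_id x).pow 2).const_mul 2 |>.add_const k).congr_deriv ?_
    simp
    ring
  rw [← gradient_add_re_im (hg (-2 * Real.cosh Q.re - c * Real.cosh Q.re ^ 2) P.re)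
    (hg (2 * (1 - 2 * μ) * Real.cos Q.im + c * Real.cos Q.im ^ 2) P.im)]
  congr 1
  funext v
  simp only [eulerReg]
  ring

theorem gradient_eulerReg_position (μ c : ℝ) (Q P : ℂ) :
    gradient (fun u => eulerReg μ c u P) Q =
      ⟨-2 * Real.sinh Q.re - 2 * c * Real.cosh Q.re * Real.sinh Q.re,
       -2 * (1 - 2 * μ) * Real.sin Q.im - 2 * c * Real.cos Q.im * Real.sin Q.im⟩ := by
  refine gradient_add_re_im
    (g := fun x => 2 * P.re ^ 2 - 2 * Real.cosh x - c * Real.cosh x ^ 2)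
    (h := fun x => 2 * P.im ^ 2 + 2 * (1 - 2 * μ) * Real.cos x + c * Real.cos x ^ 2) ?_ ?_
  · refine ((((Real.hasDerivAt_cosh Q.re).const_mul 2).const_sub (2 * P.re ^ 2)).sub
      (((Real.hasDerivAt_cosh Q.re).pow 2).const_mul c)).congr_deriv ?_
    simp
    ring
  · refine ((((Real.hasDerivAt_cos Q.im).const_mul (2 * (1 - 2 * μ))).const_add
      (2 * P.im ^ 2)).add (((Real.hasDerivAt_cos Q.im).pow 2).const_mul c)).congr_deriv ?_
    simp
    ring

/-- The branch points of the elliptic coordinates. -/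
theorem branch_point {Q : ℂ} (h : Complex.sinh Q = 0) :
    Q.re = 0 ∧ Real.sin Q.im = 0 := by
  -- Since `sinh² = cosh² - 1`, a branch point lies over one of the two centers. The distance
  -- formulas then determine `cosh λ` and `cos ν`.
  have h1 : (Complex.cosh Q / 2 - (-1 / 2)) * (Complex.cosh Q / 2 - 1 / 2) = 0 := by
    have := Complex.sinh_sq Q
    rw [h] at this
    linear_combination -this / 4
  have h2 : Real.cosh Q.re ≤ 1 ∧ Real.cos Q.im ^ 2 = 1 := by
    have hc := Real.one_le_cosh Q.re
    rcases mul_eq_zero.mp h1 with h | h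
    · have := dist_left Q
      rw [h, norm_zero] at this
      have hcos := Real.neg_one_le_cos Q.im
      have : Real.cos Q.im = -1 := by linarith
      exact ⟨by linarith, by rw [this]; norm_num⟩
    · have := dist_right Q
      rw [h, norm_zero] at this
      have hcos := Real.cos_le_one Q.im
      have : Real.cos Q.im = 1 := by linarith
      exact ⟨by linarith, by rw [this]; norm_num⟩
  constructor
  · by_contra h
    exact absurd (Real.one_lt_cosh.mpr h) (not_lt.mpr h2.1)
  · have := Real.sin_sq_add_cos_sq Q.im
    rw [h2.2] at this
    exact pow_eq_zero_iff two_ne_zero |>.mp (by linarith)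

/-- The Hill's region is the region where the effective potential in elliptic coordinates is
nonpositive. -/
theorem eulerReg_nonpos_of_mem_hillRegion {μ c : ℝ} (hμ : 0 < μ) (hμ' : μ < 1) {u : ℂ}
    (hu : Complex.cosh u / 2 ∈ hillRegion μ c) : eulerReg μ c u 0 ≤ 0 := by
  by_cases hs : Complex.sinh u = 0
  · obtain ⟨hre, hsin⟩ := branch_point hs
    have hcos : Real.cos u.im ^ 2 = 1 := by
      have := Real.sin_sq_add_cos_sq u.im
      rw [hsin] at this
      linarith
    simp only [eulerReg, hre, Real.cosh_zero, hcos, Complex.zero_re, Complex.zero_im]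
    nlinarith [Real.cos_le_one u.im, Real.neg_one_le_cos u.im]
  · have hne : ∀ a : ℂ, (a = -1 / 2 ∨ a = 1 / 2) → Complex.cosh u / 2 ≠ a := by
      intro a ha h
      have := Complex.sinh_sq u
      have h2 : Complex.cosh u = 2 * a := by rw [← h]; ring
      rw [h2] at this
      apply hs
      apply pow_eq_zero_iff two_ne_zero |>.mp
      rw [this]
      rcases ha with rfl | rfl <;> norm_num
    have hpot : eulerPotential μ (Complex.cosh u / 2) ≤ c := by
      rcases hu with h | h | h
      · exact absurd h (hne _ (Or.inl rfl))
      · exact absurd h (hne _ (Or.inr rfl))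
      · exact h
    rw [eulerReg_eq μ c u 0 hs]
    have h1 : Real.cos u.im ^ 2 ≤ 1 := Real.cos_sq_le_one _
    have h2 : 1 ≤ Real.cosh u.re ^ 2 := one_le_pow₀ (Real.one_le_cosh _)
    apply mul_nonpos_of_nonneg_of_nonpos (by linarith)
    simp only [eulerHamiltonian, zero_div, norm_zero]
    norm_num
    exact hpot

theorem subset_Ioo_of_isPreconnected {A : Set ℝ} (hA : IsPreconnected A) {a b x : ℝ} (hx : x ∈ A)
    (hxI : x ∈ Ioo a b) (ha : a ∉ A) (hb : b ∉ A) : A ⊆ Ioo a b := by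
  intro y hy
  have hord := hA.ordConnected
  constructor
  · by_contra! h
    exact ha (hord.out hy hx ⟨h, hxI.1.le⟩)
  · by_contra! h
    exact hb (hord.out hx hy ⟨hxI.2.le, h⟩)

/-- Below the critical energy, the angle `ν` cannot reach the maximum of its potential. -/
theorem eulerReg_pos_of_cos {μ c : ℝ} (hμ : 0 < μ) (hμ' : μ < 1) (hc : c < criticalEnergy μ)
    {u : ℂ} (hu : c * Real.cos u.im = -(1 - 2 * μ)) : 0 < eulerReg μ c u 0 := by
  have h0 : 0 ≤ μ * (1 - μ) := mul_nonneg hμ.le (by linarith)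
  have hs := Real.sq_sqrt h0
  have hs0 := Real.sqrt_nonneg (μ * (1 - μ))
  simp only [criticalEnergy] at hc
  have hc1 : c < -1 := by linarith
  -- The left side is `4μ(1 - μ)`, so this is the square of `c + 1 < -2√(μ(1 - μ))`. It is where
  -- subcriticality of the energy enters.
  have h1 : 1 - (1 - 2 * μ) ^ 2 < (c + 1) ^ 2 := by nlinarith
  -- For `c < -1` the `λ`-part of the potential has its minimum at `λ = 0`.
  have hcosh : 0 ≤ -2 * Real.cosh u.re - c * Real.cosh u.re ^ 2 - (-2 - c) := by
    have := Real.one_le_cosh u.re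
    have e : -2 * Real.cosh u.re - c * Real.cosh u.re ^ 2 - (-2 - c) =
      (Real.cosh u.re - 1) * (-2 - c * (Real.cosh u.re + 1)) := by ring
    rw [e]
    apply mul_nonneg (by linarith)
    nlinarith
  have e : c * eulerReg μ c u 0 = c * (-2 * Real.cosh u.re - c * Real.cosh u.re ^ 2 - (-2 - c)) +
      (-2 * c - c ^ 2 - (1 - 2 * μ) ^ 2) := by
    simp only [eulerReg, Complex.zero_re, Complex.zero_im]
    linear_combination (c * Real.cos u.im + (1 - 2 * μ)) * hu
  have h2 : c * eulerReg μ c u 0 < 0 := by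
    rw [e]
    nlinarith
  by_contra! h
  nlinarith

/-- The point that needs the energy bound is confinement of `ν`: its potential is periodic, and the
orbit must remain in the single well around `Q₀`. The barriers are the maxima of that potential,
which the region of nonpositive effective potential cannot meet. Connectedness then keeps both the
Hill's region component and the orbit between them. -/
theorem isTorusKnot_euler {k l : ℕ} (hk : 0 < k) (hl : 0 < l) (hcop : Nat.Coprime k l) {μ c : ℝ}
    (hμ : 0 < μ) (hμ' : μ < 1) (hc : c < criticalEnergy μ) {α Q P : ℝ → ℂ} {Q₀ : ℂ}
    (htype : IsTypeEuler k l μ c α Q P) (hcenter : AroundCenter μ c Q₀ Q) :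
    IsTorusKnot k l (sphereCurve Q₀ Q P) := by
  obtain ⟨⟨horb, -⟩, T₁, T₂, hT₁, hT₂, hT⟩ := htype
  obtain ⟨hQ₀, hQ0⟩ := hcenter
  obtain ⟨hre, hsin⟩ := branch_point hQ₀
  have hc1 : c < -1 := by
    have := Real.sqrt_nonneg (μ * (1 - μ))
    simp only [criticalEnergy] at hc
    linarith
  have hQd : ∀ τ, HasDerivAt Q ⟨4 * (P τ).re, 4 * (P τ).im⟩ τ := fun τ => by
    have := horb.position τ
    rwa [gradient_eulerReg_momentum] at this
  have hPd := fun τ => by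
    have := horb.momentum τ
    rwa [gradient_eulerReg_position] at this
  have hQc : Continuous Q := continuous_iff_continuousAt.mpr fun τ => (hQd τ).continuousAt
  set a := Q₀.im with ha
  set σ := Real.cos a with hσ
  have hσ2 : σ ^ 2 = 1 := by
    have := Real.sin_sq_add_cos_sq a
    rw [hsin] at this
    linarith
  have hcos : ∀ x, Real.cos x = σ * Real.cos (x - a) := by
    intro x
    have := Real.cos_add (x - a) a
    rw [sub_add_cancel, hsin] at this
    linarith
  have hsin' : ∀ x, Real.sin x = σ * Real.sin (x - a) := by
    intro x
    have := Real.sin_add (x - a) a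
    rw [sub_add_cancel, hsin] at this
    linarith
  -- In the centered variable `ν - a` both branch types have the same form: the sign `σ = ±1` only
  -- replaces `1 - 2μ` by `m`.
  set m := σ * (1 - 2 * μ) with hm
  have hm1 : |m| < 1 := by
    rw [← sq_lt_one_iff_abs_lt_one, hm, mul_pow, hσ2]
    nlinarith
  obtain ⟨hm2, hm3⟩ := abs_lt.mp hm1
  have hmc : -1 < -m / c ∧ -m / c < 1 := by
    constructor
    · rw [lt_div_iff_of_neg (by linarith)]; linarith
    · rw [div_lt_iff_of_neg (by linarith)]; linarith
  -- The half-width of the well: the force `-2 sin x (m + c cos x)` vanishes at `±X`, and `|m| < 1 <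
  -- |c|` makes `X` well defined and positive.
  set X := Real.arccos (-m / c) with hX
  have hcosX : Real.cos X = -m / c := Real.cos_arccos hmc.1.le hmc.2.le
  have hX0 : 0 < X := Real.arccos_pos.mpr hmc.2
  have hXpi : X ≤ Real.pi := Real.arccos_le_pi _
  have hbarrier : ∀ u : ℂ, eulerReg μ c u 0 ≤ 0 → u.im ≠ a - X ∧ u.im ≠ a + X := by
    intro u hu
    have key : ∀ y, Real.cos y = -m / c → u.im ≠ a + y := by
      intro y hy h
      refine absurd (eulerReg_pos_of_cos hμ hμ' hc (u := u) ?_) (not_lt.mpr hu)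
      rw [hcos, h, add_sub_cancel_left, hy, hm]
      have : c ≠ 0 := by linarith
      field_simp
      linear_combination -(1 - 2 * μ) * hσ2
    exact ⟨key (-X) (by rw [Real.cos_neg, hcosX]), key X hcosX⟩
  have hstart : (Q 0).im ∈ Ioo (a - X) (a + X) := by
    let D := connectedComponentIn {u : ℂ | Complex.cosh u / 2 ∈ hillRegion μ c} Q₀
    have hD : ∀ u ∈ D, eulerReg μ c u 0 ≤ 0 := fun u hu =>
      eulerReg_nonpos_of_mem_hillRegion hμ hμ' 
        (connectedComponentIn_subset {u : ℂ | Complex.cosh u / 2 ∈ hillRegion μ c} Q₀ hu)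
    have hQ₀D : Q₀ ∈ D := mem_connectedComponentIn
      (connectedComponentIn_nonempty_iff.mp ⟨_, hQ0⟩)
    refine subset_Ioo_of_isPreconnected (A := Complex.im '' D) ?_ ⟨_, hQ₀D, rfl⟩
      ⟨by linarith, by linarith⟩ ?_ ?_ ⟨_, hQ0, rfl⟩
    · exact isPreconnected_connectedComponentIn.image _ Complex.continuous_im.continuousOn
    · rintro ⟨u, hu, h⟩
      exact (hbarrier u (hD u hu)).1 h
    · rintro ⟨u, hu, h⟩
      exact (hbarrier u (hD u hu)).2 h
  have hstay : ∀ τ, (Q τ).im ∈ Ioo (a - X) (a + X) := by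
    have hnon : ∀ τ, eulerReg μ c (Q τ) 0 ≤ 0 := by
      intro τ
      have := horb.energy τ
      simp only [eulerReg, Complex.zero_re, Complex.zero_im] at this ⊢
      nlinarith [sq_nonneg (P τ).re, sq_nonneg (P τ).im]
    intro τ
    refine subset_Ioo_of_isPreconnected (A := range fun τ => (Q τ).im)
      (isPreconnected_range (Complex.continuous_im.comp hQc)) ⟨0, rfl⟩ hstart ?_ ?_ ⟨τ, rfl⟩
    · rintro ⟨τ, h⟩
      exact (hbarrier _ (hnon τ)).1 h
    · rintro ⟨τ, h⟩
      exact (hbarrier _ (hnon τ)).2 h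
  -- The `λ`-potential is a single global well because `c < -1`, so no confinement is needed here.
  obtain ⟨ℓ₁, hℓ₁, e₁⟩ := exists_windingLog
    (f := fun x => -2 * Real.sinh x - 2 * c * Real.cosh x * Real.sinh x)
    (W := fun x => -2 * Real.cosh x - c * Real.cosh x ^ 2) (S := univ)
    (x := fun τ => (Q τ).re) (p := fun τ => (P τ).re)
    (by fun_prop) (by simp)
    (fun x => by
      refine (((Real.hasDerivAt_cosh x).const_mul (-2)).sub
        (((Real.hasDerivAt_cosh x).pow 2).const_mul c)).congr_deriv ?_
      simp
      ring)
    (fun _ _ _ _ => mem_univ _)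
    (fun x _ hx => by
      have h1 := Real.one_le_cosh x
      have h2 : 0 < x * Real.sinh x := by
        rcases lt_or_gt_of_ne hx with h | h
        · exact mul_pos_of_neg_of_neg h (Real.sinh_neg_iff.mpr h)
        · exact mul_pos h (Real.sinh_pos_iff.mpr h)
      have h3 : 0 < -2 - 2 * c * Real.cosh x := by nlinarith
      have := mul_pos h2 h3
      linarith)
    (fun τ => hasDerivAt_re (hQd τ)) (fun τ => hasDerivAt_re (hPd τ)) (fun _ => mem_univ _) hT₁
  have hT₂' : IsMinimalPeriod (fun τ => ((Q τ).im - a, (P τ).im)) T₂ := by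
    refine ⟨hT₂.1, fun τ => ?_, fun S hS hper => hT₂.2.2 S hS fun τ => ?_⟩
    · have := hT₂.2.1 τ
      simp only [Prod.mk.injEq] at this ⊢
      exact ⟨by rw [this.1], this.2⟩
    · have := hper τ
      simp only [Prod.mk.injEq, sub_left_inj] at this ⊢
      exact this
  obtain ⟨ℓ₂, hℓ₂, e₂⟩ := exists_windingLog
    (f := fun x => -2 * m * Real.sin x - 2 * c * Real.cos x * Real.sin x)
    (W := fun x => 2 * m * Real.cos x + c * Real.cos x ^ 2) (S := Ioo (-X) X)
    (x := fun τ => (Q τ).im - a) (p := fun τ => (P τ).im)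
    (by fun_prop) (by simp)
    (fun x => by
      refine (((Real.hasDerivAt_cos x).const_mul (2 * m)).add
        (((Real.hasDerivAt_cos x).pow 2).const_mul c)).congr_deriv ?_
      simp
      ring)
    (fun u hu r hr => by
      constructor
      · nlinarith [hu.1, hu.2, hr.1, hr.2]
      · nlinarith [hu.1, hu.2, hr.1, hr.2])
    (fun x hxX hx => by
      have h2 : 0 < x * Real.sin x := by
        rcases lt_or_gt_of_ne hx with h | h
        · exact mul_pos_of_neg_of_neg h
            (Real.sin_neg_of_neg_of_neg_pi_lt h (by linarith [hxX.1]))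
        · exact mul_pos h (Real.sin_pos_of_pos_of_lt_pi h (by linarith [hxX.2]))
      have h3 : -m / c < Real.cos x := by
        rw [← hcosX, ← Real.cos_abs x]
        exact Real.cos_lt_cos_of_nonneg_of_le_pi (abs_nonneg x) hXpi (abs_lt.mpr hxX)
      rw [div_lt_iff_of_neg (by linarith)] at h3
      have := mul_pos h2 (by linarith : 0 < -2 * m - 2 * c * Real.cos x)
      linarith)
    (fun τ => (hasDerivAt_im (hQd τ)).sub_const a)
    (fun τ => (hasDerivAt_im (hPd τ)).congr_deriv (by
      simp only [Complex.neg_im]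
      rw [hcos, hsin', hm]
      linear_combination 2 * c * Real.cos ((Q τ).im - a) * Real.sin ((Q τ).im - a) * hσ2))
    (fun τ => ⟨by linarith [(hstay τ).1], by linarith [(hstay τ).2]⟩) hT₂'
  have := isTorusKnot_of_windingLogs hk hl hcop hℓ₁ hℓ₂ hT
  convert this using 1
  funext τ
  simp [sphereCurve, phasePoint, e₁, e₂, hre, ha]

/-! ### The regularized Kepler flow -/

/-- `(z, w)` is an orbit of the regularized Kepler problem of energy `e` on the zero level, and `t`
is the physical time. -/
structure IsKeplerFlow (e : ℝ) (z w : ℝ → ℂ) (t : ℝ → ℝ) : Prop where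
  position : ∀ τ, HasDerivAt z (w τ / 4) τ
  momentum : ∀ τ, HasDerivAt w (2 * e * z τ) τ
  energy : ∀ τ, keplerReg e (z τ) (w τ) = 0
  time : ∀ τ, HasDerivAt t (‖z τ‖ ^ 2) τ

theorem norm_sq_eq (z : ℂ) : ‖z‖ ^ 2 = z.re ^ 2 + z.im ^ 2 := by
  rw [← Complex.normSq_eq_norm_sq, Complex.normSq_apply]; ring

theorem hasDerivAt_quadratic (a b d x : ℝ) :
    HasDerivAt (fun x => a * x ^ 2 + b * x + d) (2 * a * x + b) x := by
  refine (((((hasDerivAt_id x).pow 2).const_mul a).add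
    ((hasDerivAt_id x).const_mul b)).add_const d).congr_deriv ?_
  simp
  ring

theorem gradient_keplerReg_momentum (e : ℝ) (z w : ℂ) :
    gradient (fun v => keplerReg e z v) w = w / 4 := by
  have h := gradient_add_re_im (hasDerivAt_quadratic (1 / 8) 0 (-1 - e * ‖z‖ ^ 2) w.re)
    (hasDerivAt_quadratic (1 / 8) 0 0 w.im)
  convert h using 1
  · congr 1
    funext v
    rw [keplerReg, norm_sq_eq v]
    ring
  · apply Complex.ext <;> simp <;> ring

theorem gradient_keplerReg_position (e : ℝ) (z w : ℂ) :
    gradient (fun u => keplerReg e u w) z = -(2 * e * z) := by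
  have h := gradient_add_re_im (hasDerivAt_quadratic (-e) 0 (‖w‖ ^ 2 / 8 - 1) z.re)
    (hasDerivAt_quadratic (-e) 0 0 z.im)
  convert h using 1
  · congr 1
    funext v
    rw [keplerReg, norm_sq_eq v]
    ring
  · apply Complex.ext <;> simp

theorem gradient_rkpReg_momentum (c : ℝ) (z w : ℂ) :
    gradient (fun v => rkpReg c z v) w = w / 4 + ‖z‖ ^ 2 / 2 * Complex.I * z := by
  have h := gradient_add_re_im
    (hasDerivAt_quadratic (1 / 8) (-(‖z‖ ^ 2 * z.im / 2)) (-1 - c * ‖z‖ ^ 2) w.re)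
    (hasDerivAt_quadratic (1 / 8) (‖z‖ ^ 2 * z.re / 2) 0 w.im)
  convert h using 1
  · congr 1
    funext v
    rw [rkpReg, angularMomentum, norm_sq_eq v]
    ring
  · have e1 : (‖z‖ : ℂ) ^ 2 / 2 = ((‖z‖ ^ 2 / 2 : ℝ) : ℂ) := by push_cast; ring
    rw [e1]
    apply Complex.ext
    · simp only [Complex.add_re, Complex.mul_re, Complex.mul_im, Complex.ofReal_re,
        Complex.ofReal_im, Complex.I_re, Complex.I_im, Complex.div_ofNat_re]
      ring
    · simp only [Complex.add_im, Complex.mul_re, Complex.mul_im, Complex.ofReal_re,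
        Complex.ofReal_im, Complex.I_re, Complex.I_im, Complex.div_ofNat_im]
      ring

theorem gradient_rkpReg_position (c : ℝ) (z w : ℂ) :
    gradient (fun u => rkpReg c u w) z =
      2 * ((angularMomentum z w / 2 - c : ℝ) : ℂ) * z - ‖z‖ ^ 2 / 2 * Complex.I * w := by
  have hre : HasFDerivAt (fun u : ℂ => u.re) Complex.reCLM z := Complex.reCLM.hasFDerivAt
  have him : HasFDerivAt (fun u : ℂ => u.im) Complex.imCLM z := Complex.imCLM.hasFDerivAt
  have hL := ((hre.mul_const w.im).sub (him.mul_const w.re)).mul_const (1 / 2 : ℝ)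
    |>.sub_const c
  have h := (((hre.pow 2).add (him.pow 2)).mul hL).const_add (‖w‖ ^ 2 / 8 - 1)
  have hg := gradient_eq_of_hasFDerivAt h
  convert hg using 1
  · congr 1
    funext u
    simp only [Pi.add_apply, Pi.mul_apply, Pi.sub_apply]
    rw [rkpReg, angularMomentum, norm_sq_eq u]
    ring
  · have e1 : (‖z‖ : ℂ) ^ 2 / 2 = ((‖z‖ ^ 2 / 2 : ℝ) : ℂ) := by push_cast; ring
    have e2 : ‖z‖ ^ 2 / 2 = (z.re ^ 2 + z.im ^ 2) / 2 := by rw [norm_sq_eq]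
    rw [e1]
    generalize ‖z‖ ^ 2 / 2 = r at e2
    apply Complex.ext
    · simp [angularMomentum]
      rw [e2]
      ring
    · simp [angularMomentum]
      rw [e2]
      ring

theorem IsLeviCivitaLift.exists_isKeplerFlow {e : ℝ} {γ z w : ℝ → ℂ}
    (h : IsLeviCivitaLift (keplerReg e) γ z w) :
    ∃ t, IsKeplerFlow e z w t ∧ ∀ τ, γ (t τ) = z τ ^ 2 := by
  obtain ⟨horb, t, ht, hγ⟩ := h
  refine ⟨t, ⟨fun τ => ?_, fun τ => ?_, horb.energy, ht⟩, hγ⟩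
  · have := horb.position τ
    rwa [gradient_keplerReg_momentum] at this
  · have := horb.momentum τ
    rwa [gradient_keplerReg_position, neg_neg] at this

theorem norm_exp_mul_I_mul (x : ℝ) (z : ℂ) : ‖Complex.exp (x * Complex.I) * z‖ = ‖z‖ := by
  rw [norm_mul, Complex.norm_exp_ofReal_mul_I, one_mul]

/-- In the rotating frame, an orbit of the rotating Kepler problem is a Kepler orbit. -/
theorem IsLeviCivitaLift.exists_isKeplerFlow_rotating {c : ℝ} {q z w : ℝ → ℂ}
    (h : IsLeviCivitaLift (rkpReg c) q z w) :
    ∃ (e : ℝ) (t : ℝ → ℝ), IsKeplerFlow e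
      (fun τ => Complex.exp ((-(t τ / 2) : ℝ) * Complex.I) * z τ)
      (fun τ => Complex.exp ((-(t τ / 2) : ℝ) * Complex.I) * w τ) t ∧
      ∀ τ, q (t τ) = z τ ^ 2 := by
  obtain ⟨horb, t, ht, hq⟩ := h
  have hz := fun τ => by
    have := horb.position τ
    rwa [gradient_rkpReg_momentum] at this
  have hw := fun τ => by
    have := horb.momentum τ
    rwa [gradient_rkpReg_position] at this
  -- Angular momentum is conserved. With `L` constant, the term `L/2 - c` acts as `-e` for the
  -- Kepler energy `e = c - L/2`.
  have hL : ∀ τ, angularMomentum (z τ) (w τ) = angularMomentum (z 0) (w 0) := by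
    have hd : ∀ τ, HasDerivAt (fun τ => angularMomentum (z τ) (w τ)) 0 τ := by
      intro τ
      refine (((hasDerivAt_re (hz τ)).mul (hasDerivAt_im (hw τ))).sub
        ((hasDerivAt_im (hz τ)).mul (hasDerivAt_re (hw τ)))).congr_deriv ?_
      have e1 : (‖z τ‖ : ℂ) ^ 2 / 2 = ((‖z τ‖ ^ 2 / 2 : ℝ) : ℂ) := by push_cast; ring
      have e2 : ∀ a : ℝ, (2 : ℂ) * (a : ℂ) = ((2 * a : ℝ) : ℂ) := fun a => by push_cast; ring
      rw [e1, e2]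
      simp only [Complex.add_re, Complex.add_im, Complex.neg_re, Complex.neg_im, Complex.sub_re,
        Complex.sub_im, Complex.mul_re, Complex.mul_im, Complex.ofReal_re,
        Complex.ofReal_im, Complex.I_re, Complex.I_im, Complex.div_ofNat_im, Complex.div_ofNat_re]
      ring
    exact fun τ => is_const_of_deriv_eq_zero (fun τ => (hd τ).differentiableAt)
      (fun τ => (hd τ).deriv) τ 0
  -- Only half the angle `t` occurs because `z` is a square root of the position.
  have hrot : ∀ τ, HasDerivAt (fun τ => Complex.exp ((-(t τ / 2) : ℝ) * Complex.I))
      (Complex.exp ((-(t τ / 2) : ℝ) * Complex.I) *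
        ((-(‖z τ‖ ^ 2 / 2) : ℝ) * Complex.I)) τ := fun τ =>
    ((((ht τ).div_const 2).neg.ofReal_comp).mul_const Complex.I).cexp
  refine ⟨c - angularMomentum (z 0) (w 0) / 2, t, ⟨fun τ => ?_, fun τ => ?_, fun τ => ?_,
    fun τ => ?_⟩, hq⟩
  · refine ((hrot τ).mul (hz τ)).congr_deriv ?_
    push_cast
    ring
  · refine ((hrot τ).mul (hw τ)).congr_deriv ?_
    rw [hL]
    push_cast
    ring
  · have := horb.energy τ
    rw [keplerReg, norm_exp_mul_I_mul, norm_exp_mul_I_mul]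
    rw [rkpReg, hL] at this
    linarith
  · rw [norm_exp_mul_I_mul]
    exact ht τ

/-! ### Explicit solution and period of the Kepler flow -/

namespace IsKeplerFlow

variable {e ω : ℝ} {z w : ℝ → ℂ} {t : ℝ → ℝ}

/-- Bounded Kepler orbits have negative energy. -/
theorem energy_neg (h : IsKeplerFlow e z w t) {C : ℝ} (hC : ∀ τ, ‖z τ‖ ^ 2 ≤ C) : e < 0 := by
  by_contra! he
  let f : ℝ → ℝ := fun τ => (z τ).re ^ 2 + (z τ).im ^ 2
  -- On the zero level, `f = |z|²` satisfies `f'' = 1 + 2 e f`. If `e ≥ 0`, then `f'' ≥ 1` and `f`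
  -- grows quadratically.
  let f' : ℝ → ℝ := fun τ => ((z τ).re * (w τ).re + (z τ).im * (w τ).im) / 2
  have hf : ∀ τ, HasDerivAt f (f' τ) τ := by
    intro τ
    refine (((hasDerivAt_re (h.position τ)).pow 2).add
      ((hasDerivAt_im (h.position τ)).pow 2)).congr_deriv ?_
    simp [f']
    ring
  have hf' : ∀ τ, HasDerivAt f' (1 + 2 * e * f τ) τ := by
    intro τ
    refine ((((hasDerivAt_re (h.position τ)).mul (hasDerivAt_re (h.momentum τ))).add
      ((hasDerivAt_im (h.position τ)).mul (hasDerivAt_im (h.momentum τ)))).div_const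
        2).congr_deriv ?_
    have := h.energy τ
    rw [keplerReg, norm_sq_eq, norm_sq_eq] at this
    have e2 : (2 : ℂ) * (e : ℂ) = ((2 * e : ℝ) : ℂ) := by push_cast; ring
    rw [e2, Complex.re_ofReal_mul, Complex.im_ofReal_mul, Complex.div_ofNat_re,
      Complex.div_ofNat_im]
    simp only [f]
    linarith
  have hfC : ∀ τ, f τ ≤ C := fun τ => by
    have := hC τ
    rwa [norm_sq_eq] at this
  have hf0 : ∀ τ, 0 ≤ f τ := fun τ => by positivity
  have h1 : ∀ τ, 0 ≤ τ → f' 0 + τ ≤ f' τ := by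
    have hm : Monotone fun τ => f' τ - τ := by
      have hd : ∀ τ, HasDerivAt (fun τ => f' τ - τ) (1 + 2 * e * f τ - 1) τ := fun τ =>
        (hf' τ).sub (hasDerivAt_id τ)
      refine monotone_of_deriv_nonneg (fun τ => (hd τ).differentiableAt) fun τ => ?_
      rw [(hd τ).deriv]
      have := mul_nonneg he (hf0 τ)
      linarith
    intro τ hτ
    have := hm hτ
    simp only at this
    linarith
  have h2 : ∀ τ, 0 ≤ τ → f 0 + f' 0 * τ + τ ^ 2 / 2 ≤ f τ := by
    have hd : ∀ τ, HasDerivAt (fun τ => f τ - (1 / 2 * τ ^ 2 + f' 0 * τ + 0))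
        (f' τ - (2 * (1 / 2) * τ + f' 0)) τ := fun τ =>
      (hf τ).sub (hasDerivAt_quadratic (1 / 2) (f' 0) 0 τ)
    have hm : MonotoneOn (fun τ => f τ - (1 / 2 * τ ^ 2 + f' 0 * τ + 0)) (Ici 0) := by
      refine monotoneOn_of_deriv_nonneg (convex_Ici 0)
        (fun τ _ => (hd τ).continuousAt.continuousWithinAt)
        (fun τ _ => (hd τ).differentiableAt.differentiableWithinAt) fun τ hτ => ?_
      rw [(hd τ).deriv]
      rw [interior_Ici] at hτ
      linarith [h1 τ (le_of_lt hτ)]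
    intro τ hτ
    have := hm (mem_Ici.mpr le_rfl) (mem_Ici.mpr hτ) hτ
    simp only at this
    linarith
  -- At this time `N` the lower bound is at least `N (N/2 - |f' 0|) = N (1 + |C|)`, which exceeds
  -- `C`.
  have hτ : 0 ≤ 2 * |f' 0| + 2 * (1 + |C|) := by positivity
  have h3 := h2 _ hτ
  have h4 := hfC (2 * |f' 0| + 2 * (1 + |C|))
  have h5 := hf0 0
  have h6 := mul_le_mul_of_nonneg_right (neg_abs_le (f' 0)) hτ
  nlinarith [abs_nonneg (f' 0), abs_nonneg C, le_abs_self C,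
    mul_nonneg (abs_nonneg (f' 0)) (abs_nonneg C)]

theorem exists_omega (he : e < 0) : ∃ ω : ℝ, 0 < ω ∧ e = -2 * ω ^ 2 := by
  refine ⟨√(-e / 2), Real.sqrt_pos.mpr (by linarith), ?_⟩
  rw [Real.sq_sqrt (by linarith)]
  ring

/-- The Kepler flow of negative energy is the flow of a harmonic oscillator. -/
theorem exists_eq (h : IsKeplerFlow (-2 * ω ^ 2) z w t) (hω : 0 < ω) :
    ∃ (A B : ℂ) (t₁ : ℝ),
      (∀ τ : ℝ, z τ = A * Complex.exp ((ω * τ : ℝ) * Complex.I) +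
        B * Complex.exp ((-(ω * τ) : ℝ) * Complex.I)) ∧
      (∀ τ : ℝ, w τ = 4 * ω * Complex.I * (A * Complex.exp ((ω * τ : ℝ) * Complex.I) -
        B * Complex.exp ((-(ω * τ) : ℝ) * Complex.I))) ∧
      (∀ τ : ℝ, ‖z τ‖ ^ 2 = 1 / (4 * ω ^ 2) + 2 * ω *
        (A * (starRingEnd ℂ) B / ω * Complex.exp ((2 * ω * τ : ℝ) * Complex.I)).re) ∧
      ∀ τ : ℝ, t τ = t₁ + τ / (4 * ω ^ 2) +
        (A * (starRingEnd ℂ) B / ω * Complex.exp ((2 * ω * τ : ℝ) * Complex.I)).im := by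
  have hω' : (ω : ℂ) ≠ 0 := by exact_mod_cast hω.ne'
  have hI := Complex.I_sq
  have hexp : ∀ (a τ : ℝ), HasDerivAt (fun τ : ℝ => Complex.exp ((a * τ : ℝ) * Complex.I))
      (Complex.exp ((a * τ : ℝ) * Complex.I) * (a * Complex.I)) τ := by
    intro a τ
    refine (((hasDerivAt_id τ).const_mul a).ofReal_comp.mul_const Complex.I).cexp.congr_deriv ?_
    simp
  have hw := fun τ => h.momentum τ
  push_cast at hw
  -- The combinations `z ∓ i w/(4ω)` are eigenvectors of the linear flow, with eigenvalues `±iω`.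
  have hconst : ∀ σ : ℝ, σ ^ 2 = 1 → ∃ A : ℂ, ∀ τ : ℝ,
      z τ - σ * Complex.I * w τ / (4 * ω) =
        2 * A * Complex.exp ((σ * (ω * τ) : ℝ) * Complex.I) := by
    intro σ hσ
    have hσ' : (σ : ℂ) ^ 2 = 1 := by exact_mod_cast hσ
    have hd : ∀ τ, HasDerivAt (fun τ => Complex.exp ((-(σ * ω) * τ : ℝ) * Complex.I) *
        (z τ - σ * Complex.I * w τ / (4 * ω))) 0 τ := by
      intro τ
      refine ((hexp (-(σ * ω)) τ).mul ((h.position τ).sub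
        (((hw τ).const_mul (σ * Complex.I)).div_const (4 * ω)))).congr_deriv ?_
      simp only [Pi.sub_apply]
      push_cast
      generalize Complex.exp _ = E
      field_simp
      linear_combination (E * w τ * σ ^ 2) * hI - E * w τ * hσ'
    have hc := is_const_of_deriv_eq_zero (fun τ => (hd τ).differentiableAt)
      fun τ => (hd τ).deriv
    refine ⟨(z 0 - σ * Complex.I * w 0 / (4 * ω)) / 2, fun τ => ?_⟩
    have h1 := hc τ 0
    simp only [mul_zero, Complex.ofReal_zero, zero_mul, Complex.exp_zero, one_mul] at h1
    rw [← h1, mul_div_cancel₀ _ two_ne_zero, mul_right_comm (Complex.exp _), ← Complex.exp_add]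
    have : (((-(σ * ω) * τ : ℝ) : ℂ) * Complex.I + ((σ * (ω * τ) : ℝ) : ℂ) * Complex.I) = 0 := by
      push_cast; ring
    rw [this, Complex.exp_zero, one_mul]
  obtain ⟨A, hA⟩ := hconst 1 (by norm_num)
  obtain ⟨B, hB⟩ := hconst (-1) (by norm_num)
  simp only [one_mul, Complex.ofReal_one, Complex.ofReal_neg, neg_mul] at hA hB
  have hz : ∀ τ : ℝ, z τ = A * Complex.exp ((ω * τ : ℝ) * Complex.I) +
      B * Complex.exp ((-(ω * τ) : ℝ) * Complex.I) := by
    intro τ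
    have h1 := hA τ
    have h2 := hB τ
    simp only [Complex.ofReal_neg, neg_mul]
    linear_combination (h1 + h2) / 2
  have hweq : ∀ τ : ℝ, w τ = 4 * ω * Complex.I * (A * Complex.exp ((ω * τ : ℝ) * Complex.I) -
      B * Complex.exp ((-(ω * τ) : ℝ) * Complex.I)) := by
    intro τ
    have h1 := hA τ
    have h2 := hB τ
    simp only [Complex.ofReal_neg, neg_mul]
    have h3 : -(2 * Complex.I * w τ / (4 * ω)) =
      2 * A * Complex.exp ((ω * τ : ℝ) * Complex.I) -
        2 * B * Complex.exp (-(((ω * τ : ℝ) : ℂ) * Complex.I)) := by linear_combination h1 - h2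
    generalize Complex.exp ((ω * τ : ℝ) * Complex.I) = a at h3
    generalize Complex.exp (-(((ω * τ : ℝ) : ℂ) * Complex.I)) = b at h3
    field_simp at h3
    linear_combination Complex.I * h3 + w τ * hI
  have hsq : ∀ a b : ℂ, ‖a + b‖ ^ 2 = ‖a‖ ^ 2 + ‖b‖ ^ 2 + 2 * (a * (starRingEnd ℂ) b).re := by
    intro a b
    simp only [← Complex.normSq_eq_norm_sq]
    rw [Complex.normSq_add]
  have hcross : ∀ τ : ℝ, A * Complex.exp ((ω * τ : ℝ) * Complex.I) *
      (starRingEnd ℂ) (B * Complex.exp ((-(ω * τ) : ℝ) * Complex.I)) =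
      ω * (A * (starRingEnd ℂ) B / ω * Complex.exp ((2 * ω * τ : ℝ) * Complex.I)) := by
    intro τ
    have e1 : (starRingEnd ℂ) (Complex.exp ((-(ω * τ) : ℝ) * Complex.I)) =
        Complex.exp ((ω * τ : ℝ) * Complex.I) := by
      rw [← Complex.exp_conj]
      simp
    have e2 : Complex.exp ((2 * ω * τ : ℝ) * Complex.I) =
        Complex.exp ((ω * τ : ℝ) * Complex.I) * Complex.exp ((ω * τ : ℝ) * Complex.I) := by
      rw [← Complex.exp_add]
      congr 1
      push_cast
      ring
    rw [map_mul, e1, e2]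
    field_simp
  have hnA : ∀ x : ℝ, ‖A * Complex.exp (x * Complex.I)‖ = ‖A‖ := fun x => by
    rw [mul_comm, norm_exp_mul_I_mul]
  have hnB : ∀ x : ℝ, ‖B * Complex.exp (x * Complex.I)‖ = ‖B‖ := fun x => by
    rw [mul_comm, norm_exp_mul_I_mul]
  have hzn : ∀ τ : ℝ, ‖z τ‖ ^ 2 = ‖A‖ ^ 2 + ‖B‖ ^ 2 + 2 * (ω *
      (A * (starRingEnd ℂ) B / ω * Complex.exp ((2 * ω * τ : ℝ) * Complex.I)).re) := by
    intro τ
    rw [hz, hsq, hnA, hnB, hcross, Complex.re_ofReal_mul]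
  have hwn : ∀ τ : ℝ, ‖w τ‖ ^ 2 = 16 * ω ^ 2 * (‖A‖ ^ 2 + ‖B‖ ^ 2 - 2 * (ω *
      (A * (starRingEnd ℂ) B / ω * Complex.exp ((2 * ω * τ : ℝ) * Complex.I)).re)) := by
    intro τ
    rw [hweq, sub_eq_add_neg, norm_mul, mul_pow, hsq, norm_neg, hnA, hnB, map_neg, mul_neg,
      hcross, Complex.neg_re, Complex.re_ofReal_mul]
    simp only [norm_mul, Complex.norm_ofNat, Complex.norm_real, Complex.norm_I, mul_one,
      Real.norm_of_nonneg hω.le]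
    ring
  -- In the energy relation the interference terms of `|z|²` and `|w|²` cancel.
  have hAB : ‖A‖ ^ 2 + ‖B‖ ^ 2 = 1 / (4 * ω ^ 2) := by
    have := h.energy 0
    rw [keplerReg, hzn, hwn] at this
    field_simp
    linarith
  have hzn' : ∀ τ : ℝ, ‖z τ‖ ^ 2 = 1 / (4 * ω ^ 2) + 2 * ω *
      (A * (starRingEnd ℂ) B / ω * Complex.exp ((2 * ω * τ : ℝ) * Complex.I)).re := by
    intro τ
    rw [hzn, hAB]
    ring
  -- Integrating `dt = |z|² dτ` gives Kepler's equation.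
  have hd : ∀ τ, HasDerivAt (fun τ => t τ - τ * (1 / (4 * ω ^ 2)) -
      (A * (starRingEnd ℂ) B / ω * Complex.exp ((2 * ω * τ : ℝ) * Complex.I)).im) 0 τ := by
    intro τ
    refine (((h.time τ).sub ((hasDerivAt_id τ).mul_const _)).sub (hasDerivAt_im
      ((hexp (2 * ω) τ).const_mul (A * (starRingEnd ℂ) B / ω)))).congr_deriv ?_
    rw [hzn', ← mul_assoc]
    generalize A * (starRingEnd ℂ) B / ω * Complex.exp ((2 * ω * τ : ℝ) * Complex.I) = u
    simp
    ring
  have hc := is_const_of_deriv_eq_zero (fun τ => (hd τ).differentiableAt)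
    fun τ => (hd τ).deriv
  refine ⟨A, B, t 0 - (A * (starRingEnd ℂ) B / ω *
    Complex.exp ((2 * ω * 0 : ℝ) * Complex.I)).im, hz, hweq, hzn', fun τ => ?_⟩
  linear_combination hc τ 0

/-- The oscillating term of Kepler's equation has period `π/ω`, half the period of `z`, because it
involves the product of the two modes. -/
theorem time_add (h : IsKeplerFlow (-2 * ω ^ 2) z w t) (hω : 0 < ω) (τ : ℝ) (n : ℤ) :
    t (τ + n * (Real.pi / ω)) = t τ + n * (Real.pi / (4 * ω ^ 3)) := by
  obtain ⟨A, B, t₁, -, -, -, ht⟩ := h.exists_eq hω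
  have e1 : Complex.exp ((2 * ω * (τ + n * (Real.pi / ω)) : ℝ) * Complex.I) =
      Complex.exp ((2 * ω * τ : ℝ) * Complex.I) := by
    rw [exp_ofReal_mul_I_eq_iff]
    exact ⟨n, by field_simp⟩
  rw [ht, ht, e1]
  field_simp
  ring

theorem surjective_time (h : IsKeplerFlow (-2 * ω ^ 2) z w t) (hω : 0 < ω) : Surjective t := by
  refine surjective_of_quasiperiodic (T := Real.pi / ω) (c := Real.pi / (4 * ω ^ 3))
    (continuous_iff_continuousAt.mpr fun τ => (h.time τ).continuousAt)
    (div_pos Real.pi_pos (by positivity)) fun τ => ?_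
  simpa using h.time_add hω τ 1

/-- The period of a Kepler ellipse. -/
theorem period_eq (h : IsKeplerFlow (-2 * ω ^ 2) z w t) (hω : 0 < ω) {A B : ℂ}
    (hz : ∀ τ : ℝ, z τ = A * Complex.exp ((ω * τ : ℝ) * Complex.I) +
        B * Complex.exp ((-(ω * τ) : ℝ) * Complex.I))
    (hn : ∀ τ : ℝ, ‖z τ‖ ^ 2 = 1 / (4 * ω ^ 2) + 2 * ω *
        (A * (starRingEnd ℂ) B / ω * Complex.exp ((2 * ω * τ : ℝ) * Complex.I)).re)
    {γ : ℝ → ℂ} (hγ : ∀ τ, γ (t τ) = z τ ^ 2) (hcirc : ¬ ∃ r : ℝ, ∀ s, ‖γ s‖ = r) {T : ℝ}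
    (hT : IsMinimalPeriod γ T) : A ≠ 0 ∧ B ≠ 0 ∧ T = Real.pi / (4 * ω ^ 3) := by
  have hpi := Real.pi_pos
  have hsurj := h.surjective_time hω
  set D := A * (starRingEnd ℂ) B / ω with hD
  have hγn : ∀ τ, ‖γ (t τ)‖ = ‖z τ‖ ^ 2 := fun τ => by rw [hγ, norm_pow]
  -- Without interference of the two modes the distance to the origin would be constant, a circular
  -- orbit.
  have hD0 : D ≠ 0 := by
    intro h0
    refine hcirc ⟨1 / (4 * ω ^ 2), fun s => ?_⟩
    obtain ⟨τ, rfl⟩ := hsurj s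
    rw [hγn, hn, h0]
    simp
  have hA : A ≠ 0 := by
    rintro rfl
    exact hD0 (by simp [hD])
  have hB : B ≠ 0 := by
    rintro rfl
    exact hD0 (by simp [hD])
  refine ⟨hA, hB, le_antisymm ?_ ?_⟩
  · refine hT.2.2 _ (by positivity) fun s => ?_
    obtain ⟨τ, rfl⟩ := hsurj s
    have h1 := h.time_add hω τ 1
    simp only [Int.cast_one, one_mul] at h1
    rw [← h1, hγ, hγ]
    -- The lift closes up only to its antipode, but its square closes up.
    have h2 : z (τ + Real.pi / ω) = -z τ := by
      have e1 : ω * (τ + Real.pi / ω) = ω * τ + Real.pi := by field_simp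
      have e2 : ((-(ω * τ + Real.pi) : ℝ) : ℂ) * Complex.I =
        ((-(ω * τ) : ℝ) : ℂ) * Complex.I - Real.pi * Complex.I := by push_cast; ring
      have e3 : ((ω * τ + Real.pi : ℝ) : ℂ) * Complex.I =
        ((ω * τ : ℝ) : ℂ) * Complex.I + Real.pi * Complex.I := by push_cast; ring
      rw [hz, hz, e1, e2, e3, Complex.exp_add, Complex.exp_sub, Complex.exp_pi_mul_I]
      ring
    rw [h2, neg_sq]
  -- `τ₀` is a time of maximal distance. One period later the distance is maximal again, which fixes
  -- `exp(2iωτ)` and makes `T` a positive multiple of `π/(4ω³)`.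
  · let τ₀ : ℝ := -Complex.arg D / (2 * ω)
    have hτ₀ : D * Complex.exp ((2 * ω * τ₀ : ℝ) * Complex.I) = ‖D‖ := by
      have e1 : 2 * ω * τ₀ = -Complex.arg D := by simp only [τ₀]; field_simp
      rw [e1]
      nth_rewrite 1 [← Complex.norm_mul_exp_arg_mul_I D]
      rw [mul_assoc, ← Complex.exp_add]
      simp
    obtain ⟨τ₁, hτ₁⟩ := hsurj (t τ₀ + T)
    have hre : (D * Complex.exp ((2 * ω * τ₁ : ℝ) * Complex.I)).re = ‖D‖ := by
      have h1 : ‖γ (t τ₁)‖ = ‖γ (t τ₀)‖ := by rw [hτ₁, hT.2.1]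
      rw [hγn, hγn, hn, hn, hτ₀, Complex.ofReal_re] at h1
      exact mul_left_cancel₀ (by positivity : 2 * ω ≠ 0) (add_left_cancel h1)
    have hτ₁' : D * Complex.exp ((2 * ω * τ₁ : ℝ) * Complex.I) = ‖D‖ := by
      have hnorm : ‖D * Complex.exp ((2 * ω * τ₁ : ℝ) * Complex.I)‖ = ‖D‖ := by
        rw [mul_comm, norm_exp_mul_I_mul]
      have hsq := norm_sq_eq (D * Complex.exp ((2 * ω * τ₁ : ℝ) * Complex.I))
      rw [hnorm, hre] at hsq
      apply Complex.ext
      · rw [hre, Complex.ofReal_re]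
      · rw [Complex.ofReal_im]
        exact pow_eq_zero_iff two_ne_zero |>.mp (by linarith)
    rw [← hτ₀] at hτ₁'
    obtain ⟨n, hn'⟩ := (exp_ofReal_mul_I_eq_iff _ _).mp (mul_left_cancel₀ hD0 hτ₁')
    have h3 : τ₁ = τ₀ + n * (Real.pi / ω) := by
      field_simp
      linarith
    rw [h3, h.time_add hω] at hτ₁
    have h4 : T = n * (Real.pi / (4 * ω ^ 3)) := by linarith
    have h5 : 0 < Real.pi / (4 * ω ^ 3) := by positivity
    have h6 : (0 : ℝ) < n := by
      have := hT.1
      rw [h4] at this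
      exact pos_of_mul_pos_left this h5.le
    have h7 : (1 : ℝ) ≤ n := by
      have : 0 < n := by exact_mod_cast h6
      exact_mod_cast this
    rw [h4]
    nlinarith

end IsKeplerFlow

/-! ### Torus knots of the rotating Kepler problem -/

/-- The imaginary parts of the phase point are the momenta. With factor `1/(4ω)` this rescaling
turns the ellipsoid of the Kepler energy `-2ω²` into a round sphere. -/
theorem planarIsotopy_im_mul {r : ℝ} (hr : 0 < r) :
    PlanarIsotopy fun s v => ⟨v.re, (1 - s + s * r) * v.im⟩ where
  continuous := by
    simp only [Complex.mk_eq_add_mul_I]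
    fun_prop
  bijective := by
    intro s hs
    have h0 : 1 - s + s * r ≠ 0 := by
      have h1 := mul_nonneg hs.1 hr.le
      rcases hs.2.eq_or_lt with rfl | h
      · linarith
      · linarith
    refine bijective_iff_has_inverse.mpr ⟨fun v => ⟨v.re, v.im / (1 - s + s * r)⟩, fun v => ?_,
      fun v => ?_⟩
    · apply Complex.ext
      · rfl
      · simp only
        field_simp
    · apply Complex.ext
      · rfl
      · simp only
        field_simp
  smul := by
    intro s r' _ v
    apply Complex.ext
    · simp
    · simp
      ring
  zero := by
    intro v
    simp

/-- The straight line of matrices from the identity to the unitary map (up to a factor) that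
diagonalizes the rotations of the plane. -/
theorem homogeneousIsotopy_diagonalize : HomogeneousIsotopy fun s v =>
    !₂[v 0 - s * Complex.I * v 1, s * v 0 + (1 - s + s * Complex.I) * v 1] where
  continuous := by
    refine (PiLp.continuous_toLp 2 _).comp (continuous_pi fun i => ?_)
    fin_cases i <;> simp <;> fun_prop
  bijective := by
    intro s hs
    -- The determinant has real part `1 - s`, which vanishes only at `s = 1`, where the determinant
    -- is `2i`.
    have hdet : (1 - s + s * Complex.I + s ^ 2 * Complex.I : ℂ) ≠ 0 := by
      intro h
      have h1 := congrArg Complex.re h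
      have h2 := congrArg Complex.im h
      simp [← Complex.ofReal_pow] at h1 h2
      nlinarith
    refine bijective_iff_has_inverse.mpr ⟨fun v =>
      !₂[((1 - s + s * Complex.I) * v 0 + s * Complex.I * v 1) /
          (1 - s + s * Complex.I + s ^ 2 * Complex.I),
        (v 1 - s * v 0) / (1 - s + s * Complex.I + s ^ 2 * Complex.I)], fun v => ?_, fun v => ?_⟩
    · ext i
      fin_cases i
      · simp only [Fin.zero_eta, Matrix.cons_val_zero, Matrix.cons_val_one]
        rw [div_eq_iff hdet]
        ring
      · simp only [Fin.mk_one, Matrix.cons_val_zero, Matrix.cons_val_one]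
        rw [div_eq_iff hdet]
        ring
    · ext i
      fin_cases i
      · simp only [Fin.zero_eta, Matrix.cons_val_zero, Matrix.cons_val_one]
        field_simp
        ring
      · simp only [Fin.mk_one, Matrix.cons_val_zero, Matrix.cons_val_one]
        field_simp
        ring
  smul := by
    intro s r _ v
    rw [real_smul_pair]
    simp only [PiLp.smul_apply, Complex.real_smul]
    congr 2
    · ring
    · congr 1
      ring
  zero := by
    intro v
    ext i
    fin_cases i <;> simp

/-- The angle by which the twist with parameter `D` rotates the two coordinates. -/
def twistAngle (D : ℂ) (v : EuclideanSpace ℂ (Fin 2)) : ℝ :=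
  (D * (starRingEnd ℂ) (v 0 * v 1)).im / ‖v‖ ^ 2

/-- The twist rotates the two coordinates of a point in opposite directions, by an angle that
depends only on their product. -/
def twist (D : ℂ) (s : ℝ) (v : EuclideanSpace ℂ (Fin 2)) : EuclideanSpace ℂ (Fin 2) :=
  !₂[Complex.exp ((s * twistAngle D v : ℝ) * Complex.I) * v 0,
     Complex.exp ((-(s * twistAngle D v) : ℝ) * Complex.I) * v 1]

/-- Opposite rotations preserve both the norm and the product of the coordinates, and the angle
depends on nothing else. Hence the twists form a one-parameter group. -/
theorem twistAngle_twist (D : ℂ) (s : ℝ) (v : EuclideanSpace ℂ (Fin 2)) :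
    twistAngle D (twist D s v) = twistAngle D v := by
  have hn : ‖twist D s v‖ = ‖v‖ := by
    rw [EuclideanSpace.norm_eq, EuclideanSpace.norm_eq, twist, Fin.sum_univ_two, Fin.sum_univ_two]
    simp only [Matrix.cons_val_zero, Matrix.cons_val_one, norm_exp_mul_I_mul]
  have hp : (twist D s v) 0 * (twist D s v) 1 = v 0 * v 1 := by
    simp only [twist, Matrix.cons_val_zero, Matrix.cons_val_one]
    rw [mul_mul_mul_comm, ← Complex.exp_add]
    simp
  rw [twistAngle, hn, hp, twistAngle]

theorem twist_twist (D : ℂ) (s s' : ℝ) (v : EuclideanSpace ℂ (Fin 2)) :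
    twist D s' (twist D s v) = twist D (s' + s) v := by
  rw [twist, twistAngle_twist]
  ext i
  fin_cases i
  · simp only [twist, Fin.zero_eta, Matrix.cons_val_zero]
    rw [← mul_assoc, ← Complex.exp_add]
    congr 2
    push_cast
    ring
  · simp only [twist, Fin.mk_one, Matrix.cons_val_one, Matrix.cons_val_zero]
    rw [← mul_assoc, ← Complex.exp_add]
    congr 2
    push_cast
    ring

theorem twist_zero (D : ℂ) (v : EuclideanSpace ℂ (Fin 2)) : twist D 0 v = v := by
  ext i
  fin_cases i <;> simp [twist]

/-- Division by `‖v‖²` makes the angle homogeneous of degree zero, and the inverse of a twist is the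
twist with parameter `-s`. -/
theorem homogeneousIsotopy_twist (D : ℂ) : HomogeneousIsotopy (twist D) where
  continuous := by
    have hg : Continuous fun u : S3 => twistAngle D u := by
      refine Continuous.div ?_ (by fun_prop) fun u => by simp
      exact Complex.continuous_im.comp (continuous_const.mul
        (Complex.continuous_conj.comp (by fun_prop)))
    have hg' : Continuous fun x : unitInterval × S3 => twistAngle D x.2 := hg.comp continuous_snd
    refine (PiLp.continuous_toLp 2 _).comp (continuous_pi fun i => ?_)
    fin_cases i <;> simp <;> fun_prop
  bijective := by
    intro s _
    refine bijective_iff_has_inverse.mpr ⟨twist D (-s), fun v => ?_, fun v => ?_⟩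
    · rw [twist_twist, neg_add_cancel, twist_zero]
    · rw [twist_twist, add_neg_cancel, twist_zero]
  smul := by
    intro s r hr v
    have h : twistAngle D (r • v) = twistAngle D v := by
      have e : D * (starRingEnd ℂ) ((r • v) 0 * (r • v) 1) =
          ((r ^ 2 : ℝ) : ℂ) * (D * (starRingEnd ℂ) (v 0 * v 1)) := by
        simp only [PiLp.smul_apply, Complex.real_smul, map_mul, Complex.conj_ofReal]
        push_cast
        ring
      rw [twistAngle, e, Complex.im_ofReal_mul, norm_smul, Real.norm_of_nonneg hr.le, mul_pow,
        mul_div_mul_left _ _ (by positivity), twistAngle]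
    rw [twist, h, twist, real_smul_pair]
    simp only [PiLp.smul_apply, Complex.real_smul]
    congr 2
    · ring
    · congr 1
      ring
  zero := twist_zero D

/-- The lift of an orbit of the rotating Kepler problem, in terms of the Kepler flow in the
rotating frame. -/
theorem isTorusKnot_rotating_kepler {k l p q m : ℕ} (hlk : l < k) (hm : 0 < m)
    (hp : p * m = k + l) (hq : q * m = k - l) (hpq : p.Coprime q) {ω : ℝ} (hω : 0 < ω)
    (hres : 1 / (4 * ω ^ 2) = 2 * l * ω / k) {A B : ℂ} (hA : A ≠ 0) (hB : B ≠ 0) {D : ℂ}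
    {t₁ : ℝ} {z w : ℝ → ℂ} {t : ℝ → ℝ}
    (hz : ∀ τ : ℝ, Complex.exp ((-(t τ / 2) : ℝ) * Complex.I) * z τ =
      A * Complex.exp ((ω * τ : ℝ) * Complex.I) + B * Complex.exp ((-(ω * τ) : ℝ) * Complex.I))
    (hw : ∀ τ : ℝ, Complex.exp ((-(t τ / 2) : ℝ) * Complex.I) * w τ =
      4 * ω * Complex.I * (A * Complex.exp ((ω * τ : ℝ) * Complex.I) -
        B * Complex.exp ((-(ω * τ) : ℝ) * Complex.I)))
    (ht : ∀ τ : ℝ, t τ = t₁ + τ / (4 * ω ^ 2) +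
      (D * Complex.exp ((2 * ω * τ : ℝ) * Complex.I)).im) :
    IsTorusKnot p q (sphereCurve 0 z w) := by
  have hω' : (ω : ℂ) ≠ 0 := by exact_mod_cast hω.ne'
  have hI := Complex.I_sq
  have hk : (0 : ℝ) < k := by exact_mod_cast (Nat.zero_le l).trans_lt hlk
  have hm' : (0 : ℝ) < m := by exact_mod_cast hm
  have hp' : (p : ℝ) * m = k + l := by exact_mod_cast hp
  have hq' : (q : ℝ) * m = k - l := by rw [← Nat.cast_sub hlk.le]; exact_mod_cast hq
  have hplus : ∀ τ : ℝ, z τ + Complex.I * (w τ / (4 * ω)) =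
      2 * B * Complex.exp ((t τ / 2 - ω * τ : ℝ) * Complex.I) := by
    intro τ
    have h1 := hz τ
    have h2 := hw τ
    have e1 : Complex.exp ((t τ / 2 - ω * τ : ℝ) * Complex.I) =
        Complex.exp ((-(ω * τ) : ℝ) * Complex.I) / Complex.exp ((-(t τ / 2) : ℝ) * Complex.I) := by
      rw [← Complex.exp_sub]
      congr 1
      push_cast
      ring
    have h0 := Complex.exp_ne_zero ((-(t τ / 2) : ℝ) * Complex.I)
    rw [e1]
    generalize Complex.exp ((-(t τ / 2) : ℝ) * Complex.I) = a at *
    generalize Complex.exp ((-(ω * τ) : ℝ) * Complex.I) = b at *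
    generalize Complex.exp ((ω * τ : ℝ) * Complex.I) = d at *
    field_simp
    linear_combination 4 * ω * h1 + Complex.I * h2 + 4 * ω * (A * d - B * b) * hI
  have hminus : ∀ τ : ℝ, z τ - Complex.I * (w τ / (4 * ω)) =
      2 * A * Complex.exp ((t τ / 2 + ω * τ : ℝ) * Complex.I) := by
    intro τ
    have h1 := hz τ
    have h2 := hw τ
    have e1 : Complex.exp ((t τ / 2 + ω * τ : ℝ) * Complex.I) =
        Complex.exp ((ω * τ : ℝ) * Complex.I) / Complex.exp ((-(t τ / 2) : ℝ) * Complex.I) := by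
      rw [← Complex.exp_sub]
      congr 1
      push_cast
      ring
    have h0 := Complex.exp_ne_zero ((-(t τ / 2) : ℝ) * Complex.I)
    rw [e1]
    generalize Complex.exp ((-(t τ / 2) : ℝ) * Complex.I) = a at *
    generalize Complex.exp ((-(ω * τ) : ℝ) * Complex.I) = b at *
    generalize Complex.exp ((ω * τ : ℝ) * Complex.I) = d at *
    field_simp
    linear_combination 4 * ω * h1 - Complex.I * h2 - 4 * ω * (A * d - B * b) * hI
  have hA' : (starRingEnd ℂ) (2 * A) ≠ 0 := by simpa using hA
  have hB' : 2 * B ≠ 0 := by simpa using hB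
  have hr : 0 < 1 / (4 * ω) := by positivity
  let F₁ := (planarIsotopy_im_mul hr).prod (planarIsotopy_im_mul hr)
  let F₂ := homogeneousIsotopy_diagonalize
  -- Constant factors remove the amplitudes `2A`, `2B` and the phase coming from the initial time
  -- `t₁`.
  let F₃ := (planarIsotopy_exp_mul (-Complex.log ((starRingEnd ℂ) (2 * A)) +
    (t₁ / 2 : ℝ) * Complex.I)).prod (planarIsotopy_exp_mul (-Complex.log (2 * B) +
      (-(t₁ / 2) : ℝ) * Complex.I))
  let F₄ := homogeneousIsotopy_twist D
  have one_mem : (1 : ℝ) ∈ Icc (0 : ℝ) 1 := ⟨zero_le_one, le_rfl⟩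
  have e₁ : ∀ τ : ℝ, (phasePoint (z τ - 0) (w τ) : EuclideanSpace ℂ (Fin 2)) ≠ 0 := by
    intro τ h
    have h0 := congrArg (fun v : EuclideanSpace ℂ (Fin 2) => v 0) h
    have h1 := congrArg (fun v : EuclideanSpace ℂ (Fin 2) => v 1) h
    simp [phasePoint, Complex.ext_iff] at h0 h1
    have hz0 : z τ = 0 := Complex.ext h0.1 h1.1
    have hw0 : w τ = 0 := Complex.ext h0.2 h1.2
    have := hplus τ
    rw [hz0, hw0] at this
    simp [hB] at this
  have step : ∀ τ : ℝ, (!₂[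
      (starRingEnd ℂ) (2 * A) * Complex.exp ((-(t τ / 2 + ω * τ) : ℝ) * Complex.I),
      2 * B * Complex.exp ((t τ / 2 - ω * τ : ℝ) * Complex.I)] : EuclideanSpace ℂ (Fin 2)) =
      !₂[(⟨(z τ).re, (1 - 1 + 1 * (1 / (4 * ω))) * (w τ).re⟩ : ℂ) - ((1 : ℝ) : ℂ) * Complex.I *
          ⟨(z τ).im, (1 - 1 + 1 * (1 / (4 * ω))) * (w τ).im⟩,
        ((1 : ℝ) : ℂ) * ⟨(z τ).re, (1 - 1 + 1 * (1 / (4 * ω))) * (w τ).re⟩ +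
          (1 - ((1 : ℝ) : ℂ) + ((1 : ℝ) : ℂ) * Complex.I) *
          ⟨(z τ).im, (1 - 1 + 1 * (1 / (4 * ω))) * (w τ).im⟩] := by
    intro τ
    -- The first coordinate is the conjugate of `z - i w/(4ω)`. This conjugation makes both final
    -- frequencies negative when `l < k`, so that the knot is positive.
    have e1 : (starRingEnd ℂ) (2 * A) * Complex.exp ((-(t τ / 2 + ω * τ) : ℝ) * Complex.I) =
        (starRingEnd ℂ) (z τ - Complex.I * (w τ / (4 * ω))) := by
      rw [hminus, map_mul _ (2 * A), ← Complex.exp_conj, map_mul _ _ Complex.I,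
        Complex.conj_ofReal, Complex.conj_I, Complex.ofReal_neg, neg_mul, mul_neg]
    have e2 : w τ / (4 * ω) = ((1 / (4 * ω) : ℝ) : ℂ) * w τ := by
      push_cast
      field_simp
    rw [e1, ← hplus, e2]
    generalize 1 / (4 * ω) = r
    ext i
    fin_cases i
    · apply Complex.ext
      · simp
      · simp
        ring
    · apply Complex.ext
      · simp
      · simp
        ring
  refine IsTorusKnot.of_homogeneousIsotopy F₁ e₁ ?_
  refine IsTorusKnot.of_homogeneousIsotopy F₂ (fun τ => F₁.ne_zero one_mem (e₁ τ)) ?_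
  simp only [phasePoint, sub_zero, Matrix.cons_val_zero, Matrix.cons_val_one]
  simp only [← step]
  refine IsTorusKnot.of_homogeneousIsotopy F₃
    (fun τ => pair_ne_zero (mul_ne_zero hA' (Complex.exp_ne_zero _))) ?_
  simp only [Matrix.cons_val_zero, Matrix.cons_val_one, Complex.ofReal_one, one_mul]
  have step' : ∀ τ : ℝ, (!₂[
      Complex.exp ((-((t τ - t₁) / 2 + ω * τ) : ℝ) * Complex.I),
      Complex.exp (((t τ - t₁) / 2 - ω * τ : ℝ) * Complex.I)] : EuclideanSpace ℂ (Fin 2)) =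
      !₂[(starRingEnd ℂ) (2 * A) * Complex.exp ((-(t τ / 2 + ω * τ) : ℝ) * Complex.I) *
          Complex.exp (-Complex.log ((starRingEnd ℂ) (2 * A)) + (t₁ / 2 : ℝ) * Complex.I),
        2 * B * Complex.exp ((t τ / 2 - ω * τ : ℝ) * Complex.I) *
          Complex.exp (-Complex.log (2 * B) + (-(t₁ / 2) : ℝ) * Complex.I)] := by
    intro τ
    have key : ∀ (u : ℂ), u ≠ 0 → ∀ x y : ℝ, u * Complex.exp (x * Complex.I) *
        Complex.exp (-Complex.log u + y * Complex.I) =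
        Complex.exp ((x + y : ℝ) * Complex.I) := by
      intro u hu x y
      rw [Complex.exp_add, Complex.exp_neg, Complex.exp_log hu, Complex.ofReal_add, add_mul,
        Complex.exp_add]
      field_simp
    rw [key _ hA', key _ hB']
    congr 6 <;> ring
  simp only [← step']
  refine IsTorusKnot.of_homogeneousIsotopy F₄
    (fun τ => pair_ne_zero (Complex.exp_ne_zero _)) ?_
  have hω₀ : -(m * ω / k) ≠ 0 := by
    have : 0 < m * ω / k := by positivity
    linarith
  convert isTorusKnot_linear hpq hω₀ using 3 with τ
  -- The product of the two coordinates is `exp(-2iωτ)` and the squared norm is 2, so the twist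
  -- angle is exactly the oscillating part of `t/2`.
  have hangle : twistAngle D !₂[
      Complex.exp ((-((t τ - t₁) / 2 + ω * τ) : ℝ) * Complex.I),
      Complex.exp (((t τ - t₁) / 2 - ω * τ : ℝ) * Complex.I)] =
      (D * Complex.exp ((2 * ω * τ : ℝ) * Complex.I)).im / 2 := by
    rw [twistAngle, norm_unit_pair (Complex.norm_exp_ofReal_mul_I _)
      (Complex.norm_exp_ofReal_mul_I _), Real.sq_sqrt two_pos.le]
    simp only [Matrix.cons_val_zero, Matrix.cons_val_one]
    rw [← Complex.exp_add, ← Complex.exp_conj]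
    congr 4
    simp only [map_add, map_mul, Complex.conj_ofReal, Complex.conj_I]
    push_cast
    ring
  rw [twist, hangle]
  have htt : t τ - t₁ = 2 * l * ω / k * τ +
      (D * Complex.exp ((2 * ω * τ : ℝ) * Complex.I)).im := by
    rw [ht, ← hres]
    ring
  generalize (D * Complex.exp ((2 * ω * τ : ℝ) * Complex.I)).im = d at *
  simp only [Matrix.cons_val_zero, Matrix.cons_val_one]
  rw [← Complex.exp_add, ← Complex.exp_add, ← add_mul, ← add_mul, ← Complex.ofReal_add,
    ← Complex.ofReal_add, htt]
  have ep : p * (-(m * ω / k) * τ) = 1 * (d / 2) +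
      -((2 * l * ω / k * τ + d) / 2 + ω * τ) := by
    field_simp
    linear_combination -2 * τ * ω * hp'
  have eq : q * (-(m * ω / k) * τ) = -(1 * (d / 2)) +
      ((2 * l * ω / k * τ + d) / 2 - ω * τ) := by
    field_simp
    linear_combination -2 * τ * ω * hq'
  rw [ep, eq]

/-- The given lift, rotated back, is a Kepler flow over the ellipse `γ'`. Its energy is never
compared with that of the lift in the definition of the ellipse: the latter only bounds `γ'`, and
boundedness makes the former negative. The period of `γ'` then determines `ω`. -/
theorem isTorusKnot_rkp {k l p q m : ℕ} (hl : 0 < l) (hlk : l < k) (hm : 0 < m)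
    (hp : p * m = k + l) (hq : q * m = k - l) (hpq : p.Coprime q) {c : ℝ} {γ z w : ℝ → ℂ}
    (htype : IsTypeRKP k l c γ) (hlift : IsLeviCivitaLift (rkpReg c) γ z w) :
    IsTorusKnot p q (sphereCurve 0 z w) := by
  obtain ⟨-, γ', T, ⟨⟨e', he', z', w', hlift'⟩, hcirc, hT⟩, hkT, hγ⟩ := htype
  obtain ⟨e, t, hflow, hγt⟩ := hlift.exists_isKeplerFlow_rotating
  obtain ⟨t', hflow', hγt'⟩ := hlift'.exists_isKeplerFlow
  have hγ't : ∀ τ, γ' (t τ) = (Complex.exp ((-(t τ / 2) : ℝ) * Complex.I) * z τ) ^ 2 := by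
    intro τ
    rw [mul_pow, ← hγt, hγ, ← Complex.exp_nat_mul, ← mul_assoc, ← Complex.exp_add]
    have : ((2 : ℕ) : ℂ) * (((-(t τ / 2) : ℝ) : ℂ) * Complex.I) + (t τ : ℂ) * Complex.I = 0 := by
      push_cast
      ring
    rw [this, Complex.exp_zero, one_mul]
  have hbound : ∀ s, ‖γ' s‖ ≤ -1 / e' := by
    obtain ⟨ω', hω', rfl⟩ := IsKeplerFlow.exists_omega he'
    intro s
    obtain ⟨τ, rfl⟩ := hflow'.surjective_time hω' s
    rw [hγt', norm_pow, le_div_iff_of_neg he']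
    have := hflow'.energy τ
    rw [keplerReg] at this
    nlinarith [sq_nonneg ‖w' τ‖]
  have he : e < 0 := hflow.energy_neg (C := -1 / e') fun τ => by
    rw [← norm_pow, ← hγ't]
    exact hbound _
  obtain ⟨ω, hω, rfl⟩ := IsKeplerFlow.exists_omega he
  obtain ⟨A, B, t₁, hz, hw, hn, ht⟩ := hflow.exists_eq hω
  obtain ⟨hA, hB, hTω⟩ := hflow.period_eq hω hz hn hγ't hcirc hT
  have hres : 1 / (4 * ω ^ 2) = 2 * l * ω / k := by
    have hk : (0 : ℝ) < k := by exact_mod_cast hl.trans hlk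
    have hpi := Real.pi_pos
    rw [hTω] at hkT
    field_simp at hkT ⊢
    linarith
  exact isTorusKnot_rotating_kepler hlk hm hp hq hpq hω hres hA hB hz hw ht

end CelestialKnots

end

/-! ### Coprimality of the winding numbers -/

theorem proposition4p4 (k l : ℕ) (hl : 0 < l) (hcop : Nat.Coprime k l) :
    (l < k → ∀ (c : ℝ) (γ z w : ℝ → ℂ), CelestialKnots.IsTypeRKP k l c γ →
      CelestialKnots.IsLeviCivitaLift (CelestialKnots.rkpReg c) γ z w →
        (Odd (k + l) → CelestialKnots.IsTorusKnot (k + l) (k - l)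
          (CelestialKnots.sphereCurve 0 z w)) ∧
        (Even (k + l) → CelestialKnots.IsTorusKnot ((k + l) / 2) ((k - l) / 2)
          (CelestialKnots.sphereCurve 0 z w))) ∧
    (0 < k → ∀ (μ c : ℝ), 0 < μ → μ < 1 → c < CelestialKnots.criticalEnergy μ →
      ∀ (α Q P : ℝ → ℂ) (Q₀ : ℂ), CelestialKnots.IsTypeEuler k l μ c α Q P →
        CelestialKnots.AroundCenter μ c Q₀ Q →
          CelestialKnots.IsTorusKnot k l (CelestialKnots.sphereCurve Q₀ Q P)) := by
  refine ⟨fun hlk c γ z w htype hlift => ⟨fun hodd => ?_, fun heven => ?_⟩,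
    fun hk μ c hμ hμ' hc α Q P Q₀ htype hcenter =>
      CelestialKnots.isTorusKnot_euler hk hl hcop hμ hμ' hc htype hcenter⟩
  · refine CelestialKnots.isTorusKnot_rkp hl hlk one_pos (mul_one _) (mul_one _) ?_ htype hlift
    -- The sum `k + l` is coprime to 2 and to `k`, hence to `2k = (k + l) + (k - l)`, hence to `k -
    -- l`.
    have h2 : Nat.Coprime (k + l) 2 := Nat.coprime_two_right.mpr hodd
    have hkl : Nat.Coprime (k + l) k := by simpa using hcop.symm
    have hsum : (k - l) + (k + l) = 2 * k := by omega
    have := h2.mul_right hkl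
    rw [← hsum] at this
    simpa using this
  · have hp : (k + l) / 2 * 2 = k + l := Nat.div_two_mul_two_of_even heven
    have hq : (k - l) / 2 * 2 = k - l := by
      obtain ⟨r, hr⟩ := heven
      omega
    refine CelestialKnots.isTorusKnot_rkp hl hlk two_pos hp hq ?_ htype hlift
    have h1 : (k - l) / 2 + l = (k + l) / 2 := by omega
    have h2 : (k + l) / 2 + (k - l) / 2 = k := by omega
    -- A common divisor of the half sum and the half difference divides `k` and `l`, which are their
    -- sum and difference.
    rw [Nat.coprime_iff_gcd_eq_one, ← Nat.dvd_one, ← hcop.gcd_eq_one]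
    have d1 := Nat.gcd_dvd_left ((k + l) / 2) ((k - l) / 2)
    have d2 := Nat.gcd_dvd_right ((k + l) / 2) ((k - l) / 2)
    refine Nat.dvd_gcd ?_ ?_
    · have := Nat.dvd_add d1 d2
      rwa [h2] at this
    · exact (Nat.dvd_add_right d2).mp (h1.symm ▸ d1)
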